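/- Let $\sigma\ge 2$, $r\ge 1$ and $N=\sigma^r$, so that $r=\log_\sigma N$, and let $S=S[1..N]$ be a string over an alphabet of $\sigma$ characters. A *meta-character* is a string of length $r$; it is stored in one machine word as a number in $\{0,\dots,N-1\}$ written in base $\sigma$. A *meta-block* of $S[1..k]$ is a substring $S[(j-1)r+1..jr]$ with $j\ge 1$ and $jr\le k$. For a meta-character $A$ and $1\le k\le N$ let $$d_{A,k}=\min\{(l-1)\bmod r \;:\; 1\le l\le k-r+1,\ S[l..l+r-1]=A\},\qquad \min\emptyset=\infty .$$ The model of computation is the unit-cost word RAM with words of $w\ge\log_2 N$ bits; its memory consists of a constant number of registers and a constant number of arrays of words, and in addition to $\sigma$ and $r$ the program is given $w$. There is a data structure (one program for all $\sigma,r,w,S$) that receives the characters $S[1],S[2],\dots,S[N]$ one at a time and has the following properties, with absolute constants in the $O$-terms. 1. Initialization and all $N$ updates together take $O(N\log N)$ time. 2. The structure occupies $O(N\log\sigma)$ bits of space plus $O(1)$ machine words, hence $O(N\log\sigma)$ bits if $w=O(\log N)$. 3. At any time, after the first $k$ characters have been received and whatever queries have been asked before, a query with any meta-character $A$ is answered in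 $O(\log N)$ time. If $k\ge r$ (in particular, if $A$ occurs in $S[1..k]$), the answer consists of a meta-character $A'$ that is a meta-block of $S[1..k]$, hence of $S$, and an integer $d$ with $0\le d\le d_{A,k}$ and $A'[1+d..r]=A[1..r-d]$ (both sides being the empty string if $d\ge r$). -/

import Mathlib

/-! ### Unit-cost word RAM -/

namespace WordRAM

/-- Binary machine instructions on `w`-bit words. -/
inductive BinOp
  | add | sub | mul | div | mod | and | or | xor | shl | shr | lt | eq

/-- Result of a binary instruction on words `x, y < 2 ^ w`. Arithmetic is modulo `2 ^ w`;
`x / 0 = 0` and `x % 0 = x`; comparisons return `0` or `1`. -/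
def BinOp.eval (w : ℕ) : BinOp → ℕ → ℕ → ℕ
  | .add, x, y => (x + y) % 2 ^ w
  | .sub, x, y => (x + (2 ^ w - y)) % 2 ^ w
  | .mul, x, y => (x * y) % 2 ^ w
  | .div, x, y => x / y
  | .mod, x, y => x % y
  | .and, x, y => x &&& y
  | .or,  x, y => x ||| y
  | .xor, x, y => x ^^^ y
  | .shl, x, y => (x <<< y) % 2 ^ w
  | .shr, x, y => x >>> y
  | .lt,  x, y => if x < y then 1 % 2 ^ w else 0
  | .eq,  x, y => if x = y then 1 % 2 ^ w else 0

/-- Programs with `m` registers and `a` arrays. Arrays are the random access memory, divided into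
a constant number of segments; the segment of an access is fixed in the program text and the
position inside the segment is read from a register. -/
inductive Cmd (m a : ℕ)
  /-- do nothing -/
  | skip : Cmd m a
  /-- `dst := v` -/
  | const (dst : Fin m) (v : ℕ) : Cmd m a
  /-- `dst := x` -/
  | copy (dst x : Fin m) : Cmd m a
  /-- `dst := x op y` -/
  | op (o : BinOp) (dst x y : Fin m) : Cmd m a
  /-- `dst := arr[idx]` -/
  | load (dst : Fin m) (arr : Fin a) (idx : Fin m) : Cmd m a
  /-- `arr[idx] := x` -/
  | store (arr : Fin a) (idx x : Fin m) : Cmd m a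
  /-- `p; q` -/
  | seq (p q : Cmd m a) : Cmd m a
  /-- `if x ≠ 0 then p else q` -/
  | ite (x : Fin m) (p q : Cmd m a) : Cmd m a
  /-- `while x ≠ 0 do p` -/
  | loop (x : Fin m) (p : Cmd m a) : Cmd m a

/-- Contents of the registers and of the arrays. -/
@[ext]
structure State (m a : ℕ) where
  reg : Fin m → ℕ
  mem : Fin a → ℕ → ℕ

namespace State

variable {m a : ℕ}

/-- All registers and all memory cells hold `0`. -/
def zero (m a : ℕ) : State m a := ⟨fun _ => 0, fun _ _ => 0⟩

def setReg (s : State m a) (x : Fin m) (v : ℕ) : State m a :=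
  { s with reg := Function.update s.reg x v }

def setMem (s : State m a) (arr : Fin a) (i v : ℕ) : State m a :=
  { s with mem := Function.update s.mem arr (Function.update (s.mem arr) i v) }

end State

/-- `Exec w size p s t s'`: on a machine with `w`-bit words whose array `arr` consists of
`size arr` words, program `p` started in state `s` halts in state `s'` after exactly `t` unit-cost
steps. Every instruction and every test of a condition takes one step. A program that accesses an
array outside its bounds has no execution. -/
inductive Exec {m a : ℕ} (w : ℕ) (size : Fin a → ℕ) :
    Cmd m a → State m a → ℕ → State m a → Prop
  | skip (s) : Exec w size .skip s 1 s
  | const (s dst v) : Exec w size (.const dst v) s 1 (s.setReg dst (v % 2 ^ w))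
  | copy (s dst x) : Exec w size (.copy dst x) s 1 (s.setReg dst (s.reg x))
  | op (s o dst x y) :
      Exec w size (.op o dst x y) s 1 (s.setReg dst (o.eval w (s.reg x) (s.reg y)))
  | load (s dst arr idx) (h : s.reg idx < size arr) :
      Exec w size (.load dst arr idx) s 1 (s.setReg dst (s.mem arr (s.reg idx)))
  | store (s arr idx x) (h : s.reg idx < size arr) :
      Exec w size (.store arr idx x) s 1 (s.setMem arr (s.reg idx) (s.reg x))
  | seq {p q s t₁ s₁ t₂ s₂} (hp : Exec w size p s t₁ s₁) (hq : Exec w size q s₁ t₂ s₂) :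
      Exec w size (.seq p q) s (t₁ + t₂) s₂
  | ite_true {x p q s t s'} (hx : s.reg x ≠ 0) (hp : Exec w size p s t s') :
      Exec w size (.ite x p q) s (t + 1) s'
  | ite_false {x p q s t s'} (hx : s.reg x = 0) (hq : Exec w size q s t s') :
      Exec w size (.ite x p q) s (t + 1) s'
  | loop_done {x p s} (hx : s.reg x = 0) : Exec w size (.loop x p) s 1 s
  | loop_step {x p s t₁ s₁ t₂ s₂} (hx : s.reg x ≠ 0) (hp : Exec w size p s t₁ s₁)
      (hl : Exec w size (.loop x p) s₁ t₂ s₂) : Exec w size (.loop x p) s (t₁ + t₂ + 1) s₂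

/-- Executions are deterministic, so "the" final state and running time are well defined. -/
theorem Exec.deterministic {m a w : ℕ} {size : Fin a → ℕ} {p : Cmd m a} {s s₁ s₂ : State m a}
    {t₁ t₂ : ℕ} (h₁ : Exec w size p s t₁ s₁) (h₂ : Exec w size p s t₂ s₂) :
    t₁ = t₂ ∧ s₁ = s₂ := by
  induction h₁ generalizing t₂ s₂ with
  | skip | const | copy | op | load | store => cases h₂; exact ⟨rfl, rfl⟩
  | seq _ _ ihp ihq =>
    cases h₂ with
    | seq hp hq =>
      obtain ⟨rfl, rfl⟩ := ihp hp
      obtain ⟨rfl, rfl⟩ := ihq hq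
      exact ⟨rfl, rfl⟩
  | ite_true hx _ ih =>
    cases h₂ with
    | ite_true _ hp => obtain ⟨rfl, rfl⟩ := ih hp; exact ⟨rfl, rfl⟩
    | ite_false hx' _ => exact absurd hx' hx
  | ite_false hx _ ih =>
    cases h₂ with
    | ite_true hx' _ => exact absurd hx hx'
    | ite_false _ hq => obtain ⟨rfl, rfl⟩ := ih hq; exact ⟨rfl, rfl⟩
  | loop_done hx =>
    cases h₂ with
    | loop_done _ => exact ⟨rfl, rfl⟩
    | loop_step hx' _ _ => exact absurd hx hx'
  | loop_step hx _ _ ihp ihl =>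
    cases h₂ with
    | loop_done hx' => exact absurd hx' hx
    | loop_step _ hp hl =>
      obtain ⟨rfl, rfl⟩ := ihp hp
      obtain ⟨rfl, rfl⟩ := ihl hl
      exact ⟨rfl, rfl⟩

end WordRAM

/-! ### Meta-characters and meta-blocks (positions are counted from `0`) -/

namespace MetaBlock

open WordRAM

variable {σ N r : ℕ}

/-- The machine word representing a meta-character: the string of `r` characters read as a number
in base `σ`, most significant character first; it is smaller than `σ ^ r`. -/
def code (A : Fin r → Fin σ) : ℕ := ∑ i : Fin r, (A i : ℕ) * σ ^ (r - 1 - (i : ℕ))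

/-- `A` occurs in `S` starting at position `l`. -/
def OccursAt (S : Fin N → Fin σ) (A : Fin r → Fin σ) (l : ℕ) : Prop :=
  ∀ i : Fin r, ∃ h : l + (i : ℕ) < N, S ⟨l + (i : ℕ), h⟩ = A i

/-- `A` is the content of a meta-block `[j * r, (j + 1) * r)` of the length `k` prefix of `S`. -/
def IsBlock (S : Fin N → Fin σ) (k : ℕ) (A : Fin r → Fin σ) : Prop :=
  ∃ j : ℕ, (j + 1) * r ≤ k ∧ OccursAt S A (j * r)

/-- The minimal offset modulo `r` of an occurrence of `A` in the length `k` prefix of `S`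
(`⊤` if there is no occurrence). -/
noncomputable def minOffset (S : Fin N → Fin σ) (k : ℕ) (A : Fin r → Fin σ) : ℕ∞ :=
  ⨅ (l : ℕ) (_ : l + r ≤ k ∧ OccursAt S A l), ((l % r : ℕ) : ℕ∞)

/-- After its first `d` characters are removed, `A'` equals `A` without its last `d` characters. -/
def ShiftMatch (A' A : Fin r → Fin σ) (d : ℕ) : Prop :=
  ∀ i j : Fin r, (j : ℕ) = (i : ℕ) + d → A' j = A i

/-- The code of an on-line data structure: three procedures, together with the registers through
which they communicate. -/
structure OnlineStructure (m a : ℕ) where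
  /-- run once, before the first character arrives -/
  setup : Cmd m a
  /-- run when the next character of the string arrives -/
  append : Cmd m a
  /-- run to answer a query -/
  query : Cmd m a
  /-- input of `setup`: the largest character `σ - 1` -/
  maxCharReg : Fin m
  /-- input of `setup`: the length `r` of a meta-character -/
  lenReg : Fin m
  /-- input of `setup`: the word size `w` -/
  wordReg : Fin m
  /-- input of `append`: the new character -/
  charReg : Fin m
  /-- input of `query`: the meta-character -/
  argReg : Fin m
  /-- output of `query`: the meta-block -/
  blockReg : Fin m
  /-- output of `query`: the shift -/
  shiftReg : Fin m

/-- The state in which `setup` is started. -/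
def OnlineStructure.start {m a : ℕ} (D : OnlineStructure m a) (σ r w : ℕ) : State m a :=
  (((State.zero m a).setReg D.maxCharReg (σ - 1)).setReg D.lenReg r).setReg D.wordReg w

/-- `D.Reach w size r S k s T`: state `s` can arise after `setup`, the arrival of the first `k`
characters of `S` one by one, and arbitrary queries in between; `T` is the total time taken by
`setup` and the `k` updates. -/
inductive OnlineStructure.Reach {m a : ℕ} (D : OnlineStructure m a) (w : ℕ) (size : Fin a → ℕ)
    (r : ℕ) (S : Fin N → Fin σ) : ℕ → State m a → ℕ → Prop
  | setup {t s} (h : Exec w size D.setup (D.start σ r w) t s) : D.Reach w size r S 0 s t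
  | append {k s T t s'} (hs : D.Reach w size r S k s T) (hk : k < N)
      (h : Exec w size D.append (s.setReg D.charReg (S ⟨k, hk⟩ : ℕ)) t s') :
      D.Reach w size r S (k + 1) s' (T + t)
  | query {k s T t s'} (hs : D.Reach w size r S k s T) (A : Fin r → Fin σ)
      (h : Exec w size D.query (s.setReg D.argReg (code A)) t s') : D.Reach w size r S k s' T

/-- Total number of bits of a machine with `m` registers and arrays of the given sizes. -/
def spaceBits {a : ℕ} (m w : ℕ) (size : Fin a → ℕ) : ℕ := (m + ∑ i, size i) * w

end MetaBlock

/-!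
The codes of the meta-blocks received so far, together with all their suffixes, form a trie of
reversed meta-blocks. A string of length `l < r` is addressed by the number with a digit `1` in
front of its `l` digits, so that three tables of at most `σ ^ r` entries of `⌈log₂ σ⌉` bits, packed
into words, suffice: marks for the complete blocks, marks for the proper suffixes, and for every
marked suffix one character that extends it to the left to a marked suffix. Entering a block takes
`O(r)` steps and is done once per `r` updates.

A query removes characters from the end of `A` until what is left is a suffix of a meta-block,
and then walks up the stored characters to a complete block `A'`. The number `d` of removed
characters is at most `(l - 1) mod r` for every occurrence of `A` at a position `l`, because the
part of such an occurrence that lies in its first meta-block is a suffix of that meta-block.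
-/

namespace WordRAM

/-! ### Total correctness of programs -/

variable {m a w : ℕ} {size : Fin a → ℕ} {p q : Cmd m a} {s s' s'' : State m a}

namespace State

theorem reg_setReg (s : State m a) (x y : Fin m) (v : ℕ) :
    (s.setReg x v).reg y = if y = x then v else s.reg y := by
  simp only [setReg, Function.update_apply]

theorem mem_setReg (s : State m a) (x : Fin m) (v : ℕ) : (s.setReg x v).mem = s.mem := rfl

end State

/-- Whether the program contains an assignment to the register `x`. -/
def Cmd.writes (x : Fin m) : Cmd m a → Bool
  | .skip | .store _ _ _ => false
  | .const dst _ | .copy dst _ | .op _ dst _ _ | .load dst _ _ => x == dst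
  | .seq p q | .ite _ p q => p.writes x || q.writes x
  | .loop _ p => p.writes x

/-- Whether the program contains a `store` instruction. -/
def Cmd.stores : Cmd m a → Bool
  | .store _ _ _ => true
  | .skip | .const _ _ | .copy _ _ | .op _ _ _ _ | .load _ _ _ => false
  | .seq p q | .ite _ p q => p.stores || q.stores
  | .loop _ p => p.stores

/-- The states `s` and `s'` differ at most in what the text of `p` allows it to change. -/
structure Frame (p : Cmd m a) (s s' : State m a) : Prop where
  reg_eq : ∀ x, p.writes x = false → s'.reg x = s.reg x
  mem_eq : p.stores = false → s'.mem = s.mem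

theorem Frame.refl (p : Cmd m a) (s : State m a) : Frame p s s := ⟨fun _ _ => rfl, fun _ => rfl⟩

theorem Frame.trans (h : Frame p s s') (h' : Frame p s' s'') : Frame p s s'' :=
  ⟨fun x hx => (h'.reg_eq x hx).trans (h.reg_eq x hx), fun hp => (h'.mem_eq hp).trans (h.mem_eq hp)⟩

theorem Frame.mono (h : Frame p s s') (hreg : ∀ x, q.writes x = false → p.writes x = false)
    (hmem : q.stores = false → p.stores = false) : Frame q s s' :=
  ⟨fun x hx => h.reg_eq x (hreg x hx), fun hq => h.mem_eq (hmem hq)⟩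

theorem Exec.frame {t : ℕ} (h : Exec w size p s t s') : Frame p s s' := by
  induction h with
  | skip | loop_done => exact Frame.refl _ _
  | const s dst | copy s dst | op s _ dst | load s dst =>
    refine ⟨fun x hx => ?_, fun _ => rfl⟩
    rw [State.reg_setReg, if_neg (by simpa [Cmd.writes] using hx)]
  | store => exact ⟨fun _ _ => rfl, fun h => by simp [Cmd.stores] at h⟩
  | seq _ _ ihp ihq =>
    exact (ihp.mono (by simp +contextual [Cmd.writes]) (by simp +contextual [Cmd.stores])).trans
      (ihq.mono (by simp +contextual [Cmd.writes]) (by simp +contextual [Cmd.stores]))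
  | ite_true _ _ ih | ite_false _ _ ih =>
    exact ih.mono (by simp +contextual [Cmd.writes]) (by simp +contextual [Cmd.stores])
  | loop_step _ _ _ ihp ihl =>
    exact (ihp.mono (by simp [Cmd.writes]) (by simp [Cmd.stores])).trans ihl

/-- The program `p` halts when started in `s`, and running time and final state satisfy `Q`. -/
def WP (w : ℕ) (size : Fin a → ℕ) (p : Cmd m a) (Q : ℕ → State m a → Prop) (s : State m a) : Prop :=
  ∃ t s', Exec w size p s t s' ∧ Q t s'

namespace WP

variable {Q R : ℕ → State m a → Prop} {n : ℕ} {x y dst idx : Fin m} {arr : Fin a}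

theorem mono (h : WP w size p Q s) (hQ : ∀ t s', Q t s' → R t s') : WP w size p R s := by
  obtain ⟨t, s', hexec, hpost⟩ := h
  exact ⟨t, s', hexec, hQ t s' hpost⟩

theorem of_exec {t : ℕ} (h : WP w size p Q s) (hexec : Exec w size p s t s') : Q t s' := by
  obtain ⟨t', s'', hexec', hpost⟩ := h
  obtain ⟨rfl, rfl⟩ := hexec.deterministic hexec'
  exact hpost

theorem frame (h : WP w size p Q s) : WP w size p (fun t s' => Q t s' ∧ Frame p s s') s := by
  obtain ⟨t, s', hexec, hpost⟩ := h
  exact ⟨t, s', hexec, hpost, hexec.frame⟩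

theorem skip_iff : WP w size .skip Q s ↔ Q 1 s :=
  ⟨fun h => h.of_exec (.skip s), fun h => ⟨1, s, .skip s, h⟩⟩

theorem const_iff {v : ℕ} : WP w size (.const dst v) Q s ↔ Q 1 (s.setReg dst (v % 2 ^ w)) :=
  ⟨fun h => h.of_exec (.const s dst v), fun h => ⟨1, _, .const s dst v, h⟩⟩

theorem copy_iff : WP w size (.copy dst x) Q s ↔ Q 1 (s.setReg dst (s.reg x)) :=
  ⟨fun h => h.of_exec (.copy s dst x), fun h => ⟨1, _, .copy s dst x, h⟩⟩

theorem op_iff {o : BinOp} :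
    WP w size (.op o dst x y) Q s ↔ Q 1 (s.setReg dst (o.eval w (s.reg x) (s.reg y))) :=
  ⟨fun h => h.of_exec (.op s o dst x y), fun h => ⟨1, _, .op s o dst x y, h⟩⟩

theorem load_iff : WP w size (.load dst arr idx) Q s ↔
    s.reg idx < size arr ∧ Q 1 (s.setReg dst (s.mem arr (s.reg idx))) := by
  constructor
  · rintro ⟨_, _, hexec, hpost⟩
    cases hexec with
    | load _ _ _ _ hidx => exact ⟨hidx, hpost⟩
  · rintro ⟨hidx, hpost⟩
    exact ⟨1, _, .load s dst arr idx hidx, hpost⟩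

theorem store_iff : WP w size (.store arr idx x) Q s ↔
    s.reg idx < size arr ∧ Q 1 (s.setMem arr (s.reg idx) (s.reg x)) := by
  constructor
  · rintro ⟨_, _, hexec, hpost⟩
    cases hexec with
    | store _ _ _ _ hidx => exact ⟨hidx, hpost⟩
  · rintro ⟨hidx, hpost⟩
    exact ⟨1, _, .store s arr idx x hidx, hpost⟩

theorem seq_iff : WP w size (.seq p q) Q s ↔
    WP w size p (fun t s' => WP w size q (fun t' => Q (t + t')) s') s := by
  constructor
  · rintro ⟨_, _, hexec, hpost⟩
    cases hexec with
    | seq hp hq => exact ⟨_, _, hp, _, _, hq, hpost⟩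
  · rintro ⟨_, _, hp, _, _, hq, hpost⟩
    exact ⟨_, _, .seq hp hq, hpost⟩

theorem seq_frame (hp : WP w size p R s)
    (hq : ∀ t s', R t s' → Frame p s s' → WP w size q (fun t' => Q (t + t')) s') :
    WP w size (.seq p q) Q s :=
  seq_iff.2 (hp.frame.mono fun t s' h => hq t s' h.1 h.2)

theorem ite (htrue : s.reg x ≠ 0 → WP w size p (fun t => Q (t + 1)) s)
    (hfalse : s.reg x = 0 → WP w size q (fun t => Q (t + 1)) s) : WP w size (.ite x p q) Q s := by
  rcases eq_or_ne (s.reg x) 0 with hx | hx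
  · obtain ⟨t, s', hexec, hpost⟩ := hfalse hx
    exact ⟨t + 1, s', .ite_false hx hexec, hpost⟩
  · obtain ⟨t, s', hexec, hpost⟩ := htrue hx
    exact ⟨t + 1, s', .ite_true hx hexec, hpost⟩

/-- The index of the loop invariant `I` is a variant: it decreases in every round. -/
theorem loop (I : ℕ → State m a → Prop) (c : ℕ)
    (hstep : ∀ n s', Frame p s s' → I n s' → s'.reg x ≠ 0 →
      WP w size p (fun t s'' => t ≤ c ∧ ∃ n' < n, I n' s'') s') (hs : I n s) :
    WP w size (.loop x p)
      (fun t s' => t ≤ n * (c + 1) + 1 ∧ s'.reg x = 0 ∧ ∃ n', I n' s') s := by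
  suffices hloop : ∀ n s', Frame p s s' → I n s' → WP w size (.loop x p)
      (fun t s'' => t ≤ n * (c + 1) + 1 ∧ s''.reg x = 0 ∧ ∃ n', I n' s'') s' from
    hloop n s (Frame.refl p s) hs
  intro n
  induction n using Nat.strong_induction_on with
  | _ n ih =>
    intro s' hframe hI
    by_cases hx : s'.reg x = 0
    · exact ⟨1, s', .loop_done hx, by omega, hx, n, hI⟩
    obtain ⟨t₁, s₁, hexec₁, ht₁, n', hn', hI₁⟩ := hstep n s' hframe hI hx
    obtain ⟨t₂, s₂, hexec₂, ht₂, hx₂, hI₂⟩ := ih n' hn' s₁ (hframe.trans hexec₁.frame) hI₁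
    refine ⟨t₁ + t₂ + 1, s₂, .loop_step hx hexec₁ hexec₂, ?_, hx₂, hI₂⟩
    calc t₁ + t₂ + 1 ≤ (n' + 1) * (c + 1) + 1 := by rw [add_one_mul]; omega
      _ ≤ n * (c + 1) + 1 := by gcongr; omega

end WP

/-! ### Word arithmetic -/

theorem div_mod_two_pow {x y : ℕ} (hx : x < 2 ^ w) (hy : y ≤ 2 ^ w) : x / (y % 2 ^ w) = x / y := by
  rcases hy.lt_or_eq with hlt | rfl
  · rw [Nat.mod_eq_of_lt hlt]
  · rw [Nat.mod_self, Nat.div_zero, Nat.div_eq_of_lt hx]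

theorem mod_add_sub_one_mod {x M : ℕ} (hx : x ≠ 0) (hxM : x ≤ M) :
    (x % M + (M - 1)) % M = x - 1 := by
  rw [Nat.mod_add_mod, show x + (M - 1) = x - 1 + M by omega, Nat.add_mod_right,
    Nat.mod_eq_of_lt (by omega)]

end WordRAM

namespace MetaBlock

open WordRAM

/-! ### Bit fields -/

/-- The bit field of width `b` at position `p` of the word `x`. -/
def getBits (b p x : ℕ) : ℕ := (x >>> p) &&& (2 ^ b - 1)

/-- The word `x` with its bit field of width `b` at position `p` replaced by `c`: the old content of
the field is cancelled by `xor`. -/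
def setBits (b p x c : ℕ) : ℕ := x ^^^ ((getBits b p x ^^^ c) <<< p)

theorem getBits_lt (b p x : ℕ) : getBits b p x < 2 ^ b := by
  rw [getBits, Nat.and_two_pow_sub_one_eq_mod]
  exact Nat.mod_lt _ (by positivity)

theorem testBit_getBits (b p x n : ℕ) :
    (getBits b p x).testBit n = (decide (n < b) && x.testBit (p + n)) := by
  rw [getBits, Nat.testBit_and, Nat.testBit_shiftRight, Nat.testBit_two_pow_sub_one, Bool.and_comm]

theorem testBit_setBits {b c : ℕ} (p x n : ℕ) (hc : c < 2 ^ b) :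
    (setBits b p x c).testBit n =
      if p ≤ n ∧ n < p + b then c.testBit (n - p) else x.testBit n := by
  rw [setBits, Nat.testBit_xor, Nat.testBit_shiftLeft, Nat.testBit_xor, testBit_getBits]
  by_cases hp : p ≤ n
  · by_cases hn : n < p + b
    · simp [hp, hn, show n - p < b by omega]
    · have hcn : c.testBit (n - p) = false :=
        Nat.testBit_lt_two_pow (hc.trans_le (Nat.pow_le_pow_right (by norm_num) (by omega)))
      simp [hn, hcn, show ¬ n - p < b by omega]
  · simp [hp]

theorem getBits_setBits_self {b c : ℕ} (p x : ℕ) (hc : c < 2 ^ b) :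
    getBits b p (setBits b p x c) = c := by
  apply Nat.eq_of_testBit_eq
  intro n
  rw [testBit_getBits, testBit_setBits p x _ hc]
  by_cases hn : n < b
  · simp [hn]
  · have hcn : c.testBit n = false :=
      Nat.testBit_lt_two_pow (hc.trans_le (Nat.pow_le_pow_right (by norm_num) (by omega)))
    simp [hn, hcn]

theorem getBits_setBits_of_disjoint {b c p p' : ℕ} (x : ℕ) (hc : c < 2 ^ b)
    (hp : p + b ≤ p' ∨ p' + b ≤ p) : getBits b p' (setBits b p x c) = getBits b p' x := by
  apply Nat.eq_of_testBit_eq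
  intro n
  rw [testBit_getBits, testBit_getBits, testBit_setBits p x _ hc]
  by_cases hn : n < b
  · rw [if_neg (by omega)]
  · simp [hn]

/-- The `i`-th entry of a packed array, in which every word holds `q` entries of `b` bits. -/
def field (b q : ℕ) (M : ℕ → ℕ) (i : ℕ) : ℕ := getBits b (i % q * b) (M (i / q))

theorem field_zero (b q i : ℕ) : field b q (fun _ => 0) i = 0 := by
  simp [field, getBits]

theorem mul_add_le_mul_of_ne {i j : ℕ} (b : ℕ) (hij : i ≠ j) :
    i * b + b ≤ j * b ∨ j * b + b ≤ i * b := by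
  simp only [← Nat.succ_mul]
  exact hij.lt_or_gt.imp (Nat.mul_le_mul_right b) (Nat.mul_le_mul_right b)

theorem field_update_setBits {b q c : ℕ} (M : ℕ → ℕ) (i : ℕ) (hc : c < 2 ^ b) :
    field b q (Function.update M (i / q) (setBits b (i % q * b) (M (i / q)) c)) =
      Function.update (field b q M) i c := by
  ext j
  rcases eq_or_ne j i with rfl | hji
  · rw [field, Function.update_self, Function.update_self, getBits_setBits_self _ _ hc]
  rw [Function.update_of_ne hji, field, field]
  rcases eq_or_ne (j / q) (i / q) with hdiv | hdiv
  · have hmod : i % q ≠ j % q := by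
      intro hmod
      rw [← Nat.div_add_mod j q, ← Nat.div_add_mod i q, hdiv, hmod] at hji
      exact hji rfl
    rw [hdiv, Function.update_self,
      getBits_setBits_of_disjoint _ hc (mul_add_le_mul_of_ne b hmod)]
  · rw [Function.update_of_ne hdiv]

/-! ### Codes of substrings -/

variable {σ N N' r : ℕ}

/-- The character of `S` at position `i` as a number; it is `0` beyond the end of `S`. -/
def charAt (S : Fin N → Fin σ) (i : ℕ) : ℕ := if h : i < N then (S ⟨i, h⟩ : ℕ) else 0

/-- The code of the substring of length `n` of `S` that starts at position `l`, evaluated by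
Horner's rule. -/
def substrCode (S : Fin N → Fin σ) (l : ℕ) : ℕ → ℕ
  | 0 => 0
  | n + 1 => substrCode S l n * σ + charAt S (l + n)

theorem charAt_of_lt (S : Fin N → Fin σ) {i : ℕ} (hi : i < N) : charAt S i = S ⟨i, hi⟩ :=
  dif_pos hi

theorem charAt_lt (hσ : 0 < σ) (S : Fin N → Fin σ) (i : ℕ) : charAt S i < σ := by
  rw [charAt]
  split_ifs
  · exact Fin.isLt _
  · exact hσ

theorem substrCode_lt (hσ : 0 < σ) (S : Fin N → Fin σ) (l n : ℕ) : substrCode S l n < σ ^ n := by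
  induction n with
  | zero => simp [substrCode]
  | succ n ih =>
    calc substrCode S l n * σ + charAt S (l + n)
        < (substrCode S l n + 1) * σ := by linarith [charAt_lt hσ S (l + n)]
      _ ≤ σ ^ (n + 1) := Nat.mul_le_mul_right σ ih

theorem substrCode_add (S : Fin N → Fin σ) (l m n : ℕ) :
    substrCode S l (m + n) = substrCode S l m * σ ^ n + substrCode S (l + m) n := by
  induction n with
  | zero => simp [substrCode]
  | succ n ih =>
    rw [← Nat.add_assoc m n 1, substrCode, ih, substrCode, Nat.add_assoc l m n]
    ring

theorem substrCode_add_div_pow (hσ : 0 < σ) (S : Fin N → Fin σ) (l m n : ℕ) :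
    substrCode S l (m + n) / σ ^ n = substrCode S l m := by
  rw [substrCode_add, mul_comm, Nat.mul_add_div (by positivity),
    Nat.div_eq_of_lt (substrCode_lt hσ S _ n), add_zero]

theorem substrCode_add_mod_pow (hσ : 0 < σ) (S : Fin N → Fin σ) (l m n : ℕ) :
    substrCode S l (m + n) % σ ^ n = substrCode S (l + m) n := by
  rw [substrCode_add, Nat.mul_add_mod', Nat.mod_eq_of_lt (substrCode_lt hσ S _ n)]

theorem substrCode_inj (hσ : 0 < σ) (S : Fin N → Fin σ) (S' : Fin N' → Fin σ) (l l' n : ℕ) :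
    substrCode S l n = substrCode S' l' n ↔ ∀ i < n, charAt S (l + i) = charAt S' (l' + i) := by
  induction n with
  | zero => simp [substrCode]
  | succ n ih =>
    rw [Nat.forall_lt_succ_right, ← ih]
    constructor
    · intro h
      have hdiv := substrCode_add_div_pow hσ S l n 1
      have hmod := substrCode_add_mod_pow hσ S l n 1
      rw [h] at hdiv hmod
      rw [substrCode_add_div_pow hσ] at hdiv
      rw [substrCode_add_mod_pow hσ] at hmod
      exact ⟨hdiv.symm, by simpa [substrCode] using hmod.symm⟩
    · rintro ⟨hinit, hlast⟩
      rw [substrCode, substrCode, hinit, hlast]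

theorem substrCode_eq_sum (S : Fin N → Fin σ) (l n : ℕ) :
    substrCode S l n = ∑ i ∈ Finset.range n, charAt S (l + i) * σ ^ (n - 1 - i) := by
  induction n with
  | zero => simp [substrCode]
  | succ n ih =>
    rw [substrCode, ih, Finset.sum_range_succ, Finset.sum_mul]
    congr 1
    · refine Finset.sum_congr rfl fun i hi => ?_
      have hi' : i < n := Finset.mem_range.1 hi
      rw [mul_assoc, ← pow_succ, show n - 1 - i + 1 = n + 1 - 1 - i by omega]
    · simp

theorem code_eq_substrCode (A : Fin r → Fin σ) : code A = substrCode A 0 r := by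
  rw [substrCode_eq_sum, Finset.sum_range, code]
  refine Finset.sum_congr rfl fun i _ => ?_
  rw [zero_add, charAt_of_lt A i.isLt]

theorem code_lt (hσ : 0 < σ) (A : Fin r → Fin σ) : code A < σ ^ r := by
  rw [code_eq_substrCode]
  exact substrCode_lt hσ A 0 r

theorem occursAt_iff_substrCode_eq (hσ : 0 < σ) {S : Fin N → Fin σ} {A : Fin r → Fin σ} {l : ℕ}
    (hl : l + r ≤ N) : OccursAt S A l ↔ substrCode S l r = code A := by
  rw [code_eq_substrCode, substrCode_inj hσ, OccursAt, Fin.forall_iff]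
  refine forall₂_congr fun i hi => ?_
  have hli : l + i < N := by omega
  rw [exists_prop_of_true hli, charAt_of_lt S hli, zero_add, charAt_of_lt A hi, Fin.val_inj]

/-- The last `r - d` digits of `X` are the first `r - d` digits of `A`, for numbers with `r` digits
in base `σ`: the relation `ShiftMatch` in terms of codes. -/
def Overlap (σ r d X A : ℕ) : Prop := X % σ ^ (r - d) = A / σ ^ d

theorem shiftMatch_iff_overlap (hσ : 0 < σ) {A' A : Fin r → Fin σ} {d : ℕ} (hd : d ≤ r) :
    ShiftMatch A' A d ↔ Overlap σ r d (code A') (code A) := by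
  have hsuffix : code A' % σ ^ (r - d) = substrCode A' d (r - d) := by
    simpa only [Nat.add_sub_cancel' hd, zero_add, ← code_eq_substrCode] using
      substrCode_add_mod_pow hσ A' 0 d (r - d)
  have hprefix : code A / σ ^ d = substrCode A 0 (r - d) := by
    simpa only [Nat.sub_add_cancel hd, ← code_eq_substrCode] using
      substrCode_add_div_pow hσ A 0 (r - d) d
  rw [Overlap, hsuffix, hprefix, substrCode_inj hσ, ShiftMatch]
  constructor
  · intro h i hi
    rw [charAt_of_lt A' (by omega), charAt_of_lt A (by omega)]
    exact congrArg Fin.val (h ⟨0 + i, by omega⟩ ⟨d + i, by omega⟩ (by simp only; omega))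
  · intro h i j hij
    have hchar := h i (by omega)
    rw [zero_add, charAt_of_lt A i.isLt, add_comm, ← hij, charAt_of_lt A' j.isLt] at hchar
    exact Fin.ext hchar

/-! ### Codes of meta-blocks -/

/-- The codes of the meta-blocks of the length `k` prefix of `S`. -/
def blockCodes (S : Fin N → Fin σ) (r k : ℕ) : Set ℕ :=
  (fun j => substrCode S (j * r) r) '' Set.Iio (k / r)

theorem blockCodes_zero (S : Fin N → Fin σ) (r : ℕ) : blockCodes S r 0 = ∅ := by
  simp [blockCodes]

theorem blockCodes_succ_of_dvd (S : Fin N → Fin σ) {r k : ℕ} (h : r ∣ k + 1) :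
    blockCodes S r (k + 1) = insert (substrCode S (k / r * r) r) (blockCodes S r k) := by
  rw [blockCodes, Nat.succ_div_of_dvd h, ← Order.succ_eq_add_one, Order.Iio_succ_eq_insert,
    Set.image_insert_eq, blockCodes]

theorem blockCodes_succ_of_not_dvd (S : Fin N → Fin σ) {r k : ℕ} (h : ¬ r ∣ k + 1) :
    blockCodes S r (k + 1) = blockCodes S r k := by
  rw [blockCodes, Nat.succ_div_of_not_dvd h, blockCodes]

theorem blockCodes_nonempty (S : Fin N → Fin σ) {r k : ℕ} (hr : 0 < r) (hk : r ≤ k) :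
    (blockCodes S r k).Nonempty :=
  ⟨_, 0, Nat.div_pos hk hr, rfl⟩

theorem lt_of_mem_blockCodes (hσ : 0 < σ) {S : Fin N → Fin σ} {r k X : ℕ}
    (hX : X ∈ blockCodes S r k) : X < σ ^ r := by
  obtain ⟨j, -, rfl⟩ := hX
  exact substrCode_lt hσ S _ r

theorem exists_isBlock_of_mem_blockCodes (hσ : 0 < σ) {S : Fin N → Fin σ} {k X : ℕ} (hk : k ≤ N)
    (hX : X ∈ blockCodes S r k) : ∃ A : Fin r → Fin σ, IsBlock S k A ∧ X = code A := by
  obtain ⟨j, hj, rfl⟩ := hX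
  have hend : (j + 1) * r ≤ k := (Nat.mul_le_mul_right r hj).trans (Nat.div_mul_le_self k r)
  have hle : j * r + r ≤ N := by rw [← Nat.succ_mul]; exact hend.trans hk
  let A : Fin r → Fin σ := fun i => S ⟨j * r + i, by omega⟩
  have hA : OccursAt S A (j * r) := fun i => ⟨by omega, rfl⟩
  exact ⟨A, ⟨j, hend, hA⟩, (occursAt_iff_substrCode_eq hσ hle).1 hA⟩

theorem exists_overlap_of_occursAt (hσ : 0 < σ) (hr : 0 < r) {S : Fin N → Fin σ} {k l : ℕ}
    {A : Fin r → Fin σ} (hk : k ≤ N) (hl : l + r ≤ k) (hA : OccursAt S A l) :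
    ∃ X ∈ blockCodes S r k, Overlap σ r (l % r) X (code A) := by
  have hlt : l % r < r := Nat.mod_lt l hr
  have hblock : l / r < k / r := by
    rw [← Nat.succ_le_iff, Nat.succ_eq_add_one, ← Nat.add_div_right l hr]
    exact Nat.div_le_div_right hl
  have hsuffix := substrCode_add_mod_pow hσ S (l / r * r) (l % r) (r - l % r)
  rw [Nat.add_sub_cancel' hlt.le, Nat.div_add_mod' l r] at hsuffix
  have hprefix := substrCode_add_div_pow hσ S l (r - l % r) (l % r)
  rw [Nat.sub_add_cancel hlt.le] at hprefix
  refine ⟨substrCode S (l / r * r) r, ⟨l / r, hblock, rfl⟩, ?_⟩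
  rw [Overlap, ← (occursAt_iff_substrCode_eq hσ (hl.trans hk)).1 hA, hsuffix, hprefix]

theorem le_minOffset (hσ : 0 < σ) (hr : 0 < r) {S : Fin N → Fin σ} {k d : ℕ} {A : Fin r → Fin σ}
    (hk : k ≤ N) (hmin : ∀ X ∈ blockCodes S r k, ∀ d' < d, ¬ Overlap σ r d' X (code A)) :
    (d : ℕ∞) ≤ minOffset S k A := by
  refine le_iInf₂ fun l hl => ?_
  obtain ⟨X, hX, hoverlap⟩ := exists_overlap_of_occursAt hσ hr hk hl.1 hl.2
  rw [Nat.cast_le]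
  by_contra! hlt
  exact hmin X hX (l % r) hlt hoverlap

/-! ### The trie of reversed meta-blocks -/

local notation "leafArr" => (0 : Fin 3)
local notation "nodeArr" => (1 : Fin 3)
local notation "charArr" => (2 : Fin 3)

/-- The table position of the trie node whose string has length `l` and code `x`: the number whose
base `σ` digits are those of the string with a `1` in front, so that all strings shorter than `r`
share one table of size `σ ^ r`. -/
def slot (σ l x : ℕ) : ℕ := σ ^ l + x

theorem slot_lt (hσ : 2 ≤ σ) {l x : ℕ} (hl : l < r) (hx : x < σ ^ l) : slot σ l x < σ ^ r :=
  calc slot σ l x < 2 * σ ^ l := by rw [slot]; omega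
    _ ≤ σ * σ ^ l := Nat.mul_le_mul_right _ hσ
    _ = σ ^ (l + 1) := (pow_succ' σ l).symm
    _ ≤ σ ^ r := Nat.pow_le_pow_right (by omega) hl

theorem log_slot (hσ : 2 ≤ σ) {l x : ℕ} (hx : x < σ ^ l) : Nat.log σ (slot σ l x) = l :=
  Nat.log_eq_of_pow_le_of_lt_pow (Nat.le_add_right _ _) (slot_lt hσ l.lt_succ_self hx)

theorem slot_inj (hσ : 2 ≤ σ) {l l' x x' : ℕ} (hx : x < σ ^ l) (hx' : x' < σ ^ l')
    (h : slot σ l x = slot σ l' x') : l = l' ∧ x = x' := by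
  obtain rfl : l = l' := by rw [← log_slot hσ hx, h, log_slot hσ hx']
  exact ⟨rfl, Nat.add_left_cancel h⟩

/-- The tables `T` after the entry `i` of the table `arr` is replaced by `c`. -/
def setEntry {a : ℕ} (T : Fin a → ℕ → ℕ) (arr : Fin a) (i c : ℕ) : Fin a → ℕ → ℕ :=
  Function.update T arr (Function.update (T arr) i c)

/-- The tables `T` store the trie of the reversed strings with codes in `B`: a string of length `r`
is marked in the leaf table if it is in `B`; a marked entry of the node table is a proper suffix of
a string in `B`, and the character table holds a character that extends it to the left. The suffix
of `X` of length `l` is guaranteed to be marked only for `(X, l) ∈ E`. -/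
structure IsTrie (σ r : ℕ) (T : Fin 3 → ℕ → ℕ) (B : Set ℕ) (E : Set (ℕ × ℕ)) : Prop where
  leaf_ne_zero_iff : ∀ X, T leafArr X ≠ 0 ↔ X ∈ B
  char_lt : ∀ i, T charArr i < σ
  node_ne_zero : ∀ X l, (X, l) ∈ E → l < r → T nodeArr (slot σ l (X % σ ^ l)) ≠ 0
  exists_of_node_ne_zero : ∀ l < r, ∀ x < σ ^ l, T nodeArr (slot σ l x) ≠ 0 →
    ∃ X ∈ B, X % σ ^ l = x ∧ X / σ ^ l % σ = T charArr (slot σ l x)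

namespace IsTrie

variable {T : Fin 3 → ℕ → ℕ} {B : Set ℕ} {E E' : Set (ℕ × ℕ)}

theorem empty (hσ : 0 < σ) : IsTrie σ r (fun _ _ => 0) ∅ ∅ where
  leaf_ne_zero_iff := by simp
  char_lt _ := hσ
  node_ne_zero := by simp
  exists_of_node_ne_zero := by simp

theorem mono (h : IsTrie σ r T B E) (hE : ∀ X l, (X, l) ∈ E' → l < r → (X, l) ∈ E) :
    IsTrie σ r T B E' :=
  { h with node_ne_zero := fun X l hXl hl => h.node_ne_zero X l (hE X l hXl hl) hl }

theorem setLeaf (h : IsTrie σ r T B E) (X : ℕ) {c : ℕ} (hc : c ≠ 0) :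
    IsTrie σ r (setEntry T leafArr X c) (insert X B) E where
  leaf_ne_zero_iff Y := by
    rcases eq_or_ne Y X with rfl | hY
    · simp [setEntry, hc]
    · simp [setEntry, hY, h.leaf_ne_zero_iff]
  char_lt := h.char_lt
  node_ne_zero := h.node_ne_zero
  exists_of_node_ne_zero l hl x hx hnode := by
    obtain ⟨Y, hY, hsuffix⟩ := h.exists_of_node_ne_zero l hl x hx hnode
    exact ⟨Y, Set.mem_insert_of_mem X hY, hsuffix⟩

theorem setNode (h : IsTrie σ r T B E) (hσ : 2 ≤ σ) {X l c : ℕ} (hX : X ∈ B) (hc : c ≠ 0) :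
    IsTrie σ r (setEntry (setEntry T charArr (slot σ l (X % σ ^ l)) (X / σ ^ l % σ))
      nodeArr (slot σ l (X % σ ^ l)) c) B (insert (X, l) E) where
  leaf_ne_zero_iff := h.leaf_ne_zero_iff
  char_lt i := by
    rcases eq_or_ne i (slot σ l (X % σ ^ l)) with rfl | hi
    · simpa [setEntry] using Nat.mod_lt _ (by omega)
    · simpa [setEntry, hi] using h.char_lt i
  node_ne_zero Y l' hY hl' := by
    by_cases heq : slot σ l' (Y % σ ^ l') = slot σ l (X % σ ^ l)
    · simpa [setEntry, heq] using hc
    · have hne : (Y, l') ≠ (X, l) := by rintro ⟨⟩; exact heq rfl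
      simpa [setEntry, heq] using h.node_ne_zero Y l' (Set.mem_of_mem_insert_of_ne hY hne) hl'
  exists_of_node_ne_zero l' hl' x hx hnode := by
    by_cases heq : slot σ l' x = slot σ l (X % σ ^ l)
    · obtain ⟨rfl, rfl⟩ := slot_inj hσ hx (Nat.mod_lt _ (by positivity)) heq
      exact ⟨X, hX, rfl, by simp [setEntry]⟩
    · have hold : T nodeArr (slot σ l' x) ≠ 0 := by simpa [setEntry, heq] using hnode
      simpa [setEntry, heq] using h.exists_of_node_ne_zero l' hl' x hx hold

theorem node_ne_zero_iff (h : IsTrie σ r T B (B ×ˢ Set.univ)) {l x : ℕ} (hl : l < r)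
    (hx : x < σ ^ l) : T nodeArr (slot σ l x) ≠ 0 ↔ ∃ X ∈ B, X % σ ^ l = x := by
  constructor
  · intro hnode
    obtain ⟨X, hX, hsuffix, -⟩ := h.exists_of_node_ne_zero l hl x hx hnode
    exact ⟨X, hX, hsuffix⟩
  · rintro ⟨X, hX, rfl⟩
    exact h.node_ne_zero X l ⟨hX, trivial⟩ hl

theorem exists_mod_pow_succ_eq (h : IsTrie σ r T B (B ×ˢ Set.univ)) {l x : ℕ} (hl : l < r)
    (hx : x < σ ^ l) (hX : ∃ X ∈ B, X % σ ^ l = x) :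
    ∃ X ∈ B, X % σ ^ (l + 1) = x + σ ^ l * T charArr (slot σ l x) := by
  obtain ⟨X, hXB, hsuffix, hchar⟩ :=
    h.exists_of_node_ne_zero l hl x hx ((h.node_ne_zero_iff hl hx).2 hX)
  exact ⟨X, hXB, by rw [Nat.mod_pow_succ, hsuffix, hchar]⟩

end IsTrie

/-! ### The programs -/

infixr:60 " ;; " => Cmd.seq

local notation "rMax" => (0 : Fin 23)
local notation "rLen" => (1 : Fin 23)
local notation "rWord" => (2 : Fin 23)
local notation "rChar" => (3 : Fin 23)
local notation "rArg" => (4 : Fin 23)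
local notation "rBlock" => (5 : Fin 23)
local notation "rShift" => (6 : Fin 23)
local notation "rSig" => (7 : Fin 23)
local notation "rBits" => (8 : Fin 23)
local notation "rMask" => (9 : Fin 23)
local notation "rPer" => (10 : Fin 23)
local notation "rTopPow" => (11 : Fin 23)
local notation "rOne" => (12 : Fin 23)
local notation "rCur" => (13 : Fin 23)
local notation "rCnt" => (14 : Fin 23)
local notation "rPow" => (15 : Fin 23)
local notation "rIdx" => (16 : Fin 23)
local notation "rVal" => (17 : Fin 23)
local notation "rCell" => (18 : Fin 23)
local notation "rPos" => (19 : Fin 23)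
local notation "rOld" => (20 : Fin 23)
local notation "rDiff" => (21 : Fin 23)
local notation "rFlag" => (22 : Fin 23)

/-- `rVal := arr[rIdx]` in a packed array. -/
def fetch (arr : Fin 3) : Cmd 23 3 :=
  .op .div rCell rIdx rPer ;; .op .mod rPos rIdx rPer ;; .op .mul rPos rPos rBits ;;
  .load rVal arr rCell ;; .op .shr rVal rVal rPos ;; .op .and rVal rVal rMask

/-- `arr[rIdx] := rVal` in a packed array. -/
def put (arr : Fin 3) : Cmd 23 3 :=
  .op .div rCell rIdx rPer ;; .op .mod rPos rIdx rPer ;; .op .mul rPos rPos rBits ;;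
  .load rOld arr rCell ;; .op .shr rDiff rOld rPos ;; .op .and rDiff rDiff rMask ;;
  .op .xor rDiff rDiff rVal ;; .op .shl rDiff rDiff rPos ;; .op .xor rOld rOld rDiff ;;
  .store arr rCell rOld

/-- `rBits := ⌈log₂ σ⌉`, the width of a table entry, starting from `rBits = 0`. -/
def computeBits : Cmd 23 3 :=
  .copy rFlag rMax ;; .loop rFlag (.op .add rBits rBits rOne ;; .op .shr rFlag rMax rBits)

/-- `rTopPow := σ ^ (r - 1)`. -/
def computePow : Cmd 23 3 :=
  .copy rTopPow rOne ;; .op .sub rFlag rLen rOne ;;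
  .loop rFlag (.op .mul rTopPow rTopPow rSig ;; .op .sub rFlag rFlag rOne)

/-- Computes the parameters of the structure. -/
def setupCmd : Cmd 23 3 :=
  .const rOne 1 ;; .op .add rSig rMax rOne ;; computeBits ;;
  .op .shl rMask rOne rBits ;; .op .sub rMask rMask rOne ;; .op .div rPer rWord rBits ;; computePow

/-- Marks the trie node `rIdx` and stores the character `rVal` that extends it to the left. -/
def enterNode : Cmd 23 3 := put charArr ;; .copy rVal rOne ;; put nodeArr

/-- Replaces the string `rBlock` by its longest proper suffix, whose number of characters is the
exponent of `rPow`, and enters that suffix into the trie. -/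
def insertStep : Cmd 23 3 :=
  .op .div rVal rBlock rPow ;; .op .mod rBlock rBlock rPow ;; .op .add rIdx rPow rBlock ;;
  enterNode ;; .op .div rPow rPow rSig

/-- Enters the block `rCur` and all its proper suffixes into the trie. -/
def insertCmd : Cmd 23 3 :=
  .copy rIdx rCur ;; .copy rVal rOne ;; put leafArr ;;
  .copy rBlock rCur ;; .copy rPow rTopPow ;; .loop rPow insertStep

/-- Enters the block `rCur` into the trie and starts a new block. -/
def flushCmd : Cmd 23 3 := insertCmd ;; .const rCur 0 ;; .const rCnt 0

/-- Appends `rChar` to the incomplete last block `rCur`, which has `rCnt` characters. -/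
def appendCmd : Cmd 23 3 :=
  .op .mul rCur rCur rSig ;; .op .add rCur rCur rChar ;; .op .add rCnt rCnt rOne ;;
  .op .eq rFlag rCnt rLen ;;
  .ite rFlag flushCmd .skip

/-- Makes `rFlag` nonzero if the string `rBlock` is neither empty nor in the trie. -/
def testNode : Cmd 23 3 :=
  .op .add rIdx rPow rBlock ;; fetch nodeArr ;; .op .lt rFlag rOne rPow ;; .op .lt rFlag rVal rFlag

/-- Removes the last character of `rBlock`. -/
def shortenStep : Cmd 23 3 :=
  .op .div rBlock rBlock rSig ;; .op .div rPow rPow rSig ;; .op .add rShift rShift rOne ;; testNode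

/-- Finds the longest proper prefix of `rArg` that is a suffix of a block. -/
def searchCmd : Cmd 23 3 :=
  .op .div rBlock rArg rSig ;; .copy rPow rTopPow ;; .copy rShift rOne ;; testNode ;;
  .loop rFlag shortenStep

/-- Extends `rBlock` to the left by the stored character. -/
def extendStep : Cmd 23 3 :=
  .op .add rIdx rPow rBlock ;; fetch charArr ;; .op .mul rVal rPow rVal ;;
  .op .add rBlock rBlock rVal ;; .op .mul rPow rPow rSig ;; .op .sub rFlag rFlag rOne

/-- Extends `rBlock`, a string of length `rLen - rShift`, to a block. -/
def extendCmd : Cmd 23 3 := .copy rFlag rShift ;; .loop rFlag extendStep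

/-- Finds the longest prefix of `rArg` that is a suffix of a block and extends it to a block. -/
def queryCmd : Cmd 23 3 :=
  .copy rBlock rArg ;; .copy rIdx rArg ;; fetch leafArr ;; .ite rVal (.const rShift 0) searchCmd ;;
  extendCmd

/-- The online structure that keeps the trie of the reversed meta-blocks in three packed tables. -/
def trieStructure : OnlineStructure 23 3 where
  setup := setupCmd
  append := appendCmd
  query := queryCmd
  maxCharReg := rMax
  lenReg := rLen
  wordReg := rWord
  charReg := rChar
  argReg := rArg
  blockReg := rBlock
  shiftReg := rShift

/-! ### Parameters and packed tables -/

/-- The parameters that the structure can handle. -/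
structure Admissible (σ r w : ℕ) : Prop where
  two_le : 2 ≤ σ
  one_le : 1 ≤ r
  pow_le : σ ^ r ≤ 2 ^ w

/-- The number of table entries that are packed into a word. -/
def perWord (σ w : ℕ) : ℕ := w / Nat.clog 2 σ

/-- The number of words of each of the three tables. -/
def arraySize (σ r w : ℕ) (_ : Fin 3) : ℕ := σ ^ r / perWord σ w + 1

namespace Admissible

variable {w : ℕ}

theorem base_pos (h : Admissible σ r w) : 0 < σ := two_pos.trans_le h.two_le

theorem base_le (h : Admissible σ r w) : σ ≤ 2 ^ w :=
  (Nat.le_self_pow (Nat.one_le_iff_ne_zero.1 h.one_le) σ).trans h.pow_le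

theorem one_lt (h : Admissible σ r w) : 1 < 2 ^ w := h.two_le.trans h.base_le

theorem pow_lt (h : Admissible σ r w) {l : ℕ} (hl : l < r) : σ ^ l < 2 ^ w :=
  (Nat.pow_lt_pow_right h.two_le hl).trans_le h.pow_le

theorem len_lt (h : Admissible σ r w) : r < 2 ^ w :=
  (Nat.lt_pow_self h.two_le).trans_le h.pow_le

theorem clog_le (h : Admissible σ r w) : Nat.clog 2 σ ≤ w :=
  Nat.clog_le_of_le_pow h.base_le

theorem perWord_pos (h : Admissible σ r w) : 0 < perWord σ w :=
  Nat.div_pos h.clog_le (Nat.clog_pos one_lt_two h.two_le)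

theorem pos_add_clog_le (h : Admissible σ r w) (i : ℕ) :
    i % perWord σ w * Nat.clog 2 σ + Nat.clog 2 σ ≤ w :=
  calc i % perWord σ w * Nat.clog 2 σ + Nat.clog 2 σ
      = (i % perWord σ w + 1) * Nat.clog 2 σ := (Nat.succ_mul _ _).symm
    _ ≤ perWord σ w * Nat.clog 2 σ := Nat.mul_le_mul_right _ (Nat.mod_lt i h.perWord_pos)
    _ ≤ w := Nat.div_mul_le_self w _

theorem pos_lt (h : Admissible σ r w) (i : ℕ) : i % perWord σ w * Nat.clog 2 σ < 2 ^ w :=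
  (le_self_add.trans (h.pos_add_clog_le i)).trans_lt Nat.lt_two_pow_self

end Admissible

theorem div_perWord_lt_arraySize {w i : ℕ} (hi : i < σ ^ r) (arr : Fin 3) :
    i / perWord σ w < arraySize σ r w arr :=
  Nat.lt_succ_of_le (Nat.div_le_div_right hi.le)

/-- The registers that are computed by `setup` or kept from its input, and not changed later. -/
def paramRegs : List (Fin 23) := [rLen, rSig, rBits, rMask, rPer, rTopPow, rOne]

/-- The parameters are in their registers; `rSig` holds `0` if `σ = 2 ^ w`. -/
structure Params (σ r w : ℕ) (s : State 23 3) : Prop where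
  len : s.reg rLen = r
  sig : s.reg rSig = σ % 2 ^ w
  bits : s.reg rBits = Nat.clog 2 σ
  mask : s.reg rMask = 2 ^ Nat.clog 2 σ - 1
  per : s.reg rPer = perWord σ w
  topPow : s.reg rTopPow = σ ^ (r - 1)
  one : s.reg rOne = 1

/-- The contents of the three packed tables. -/
def tables (σ w : ℕ) (s : State 23 3) (arr : Fin 3) : ℕ → ℕ :=
  field (Nat.clog 2 σ) (perWord σ w) (s.mem arr)

section

variable {w : ℕ} {s s' : State 23 3} {p : Cmd 23 3}

theorem Params.congr (h : Params σ r w s) (hs : ∀ x ∈ paramRegs, s'.reg x = s.reg x) :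
    Params σ r w s' where
  len := (hs rLen (by decide)).trans h.len
  sig := (hs rSig (by decide)).trans h.sig
  bits := (hs rBits (by decide)).trans h.bits
  mask := (hs rMask (by decide)).trans h.mask
  per := (hs rPer (by decide)).trans h.per
  topPow := (hs rTopPow (by decide)).trans h.topPow
  one := (hs rOne (by decide)).trans h.one

theorem Params.setReg (h : Params σ r w s) {x : Fin 23} (v : ℕ)
    (hx : x ∉ paramRegs := by decide) : Params σ r w (s.setReg x v) := by
  refine h.congr fun y hy => ?_
  rw [State.reg_setReg, if_neg (ne_of_mem_of_not_mem hy hx)]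

theorem Params.of_frame (h : Params σ r w s) (hframe : Frame p s s')
    (hp : ∀ x ∈ paramRegs, p.writes x = false := by decide) : Params σ r w s' :=
  h.congr fun x hx => hframe.reg_eq x (hp x hx)

theorem tables_of_frame (hframe : Frame p s s') (hp : p.stores = false) :
    tables σ w s' = tables σ w s := by
  ext arr
  rw [tables, tables, hframe.mem_eq hp]

theorem tables_setMem (s : State 23 3) (arr : Fin 3) (i : ℕ) {c : ℕ} (hc : c < 2 ^ Nat.clog 2 σ) :
    tables σ w (s.setMem arr (i / perWord σ w) (setBits (Nat.clog 2 σ)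
      (i % perWord σ w * Nat.clog 2 σ) (s.mem arr (i / perWord σ w)) c)) =
      setEntry (tables σ w s) arr i c := by
  ext arr' : 1
  rcases eq_or_ne arr' arr with rfl | harr
  · simp only [tables, State.setMem, setEntry, Function.update_self, field_update_setBits _ i hc]
  · simp only [tables, State.setMem, setEntry, Function.update_of_ne harr]

theorem fetch_wp (hp : Admissible σ r w) (hs : Params σ r w s) {arr : Fin 3}
    (hi : s.reg rIdx < σ ^ r) :
    WP w (arraySize σ r w) (fetch arr)
      (fun t s' => t = 6 ∧ s'.reg rVal = tables σ w s arr (s.reg rIdx)) s := by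
  simp only [fetch, WP.seq_iff, WP.op_iff, WP.load_iff, BinOp.eval, State.reg_setReg,
    State.mem_setReg, Fin.reduceEq, if_true, if_false, hs.per, hs.bits, hs.mask,
    Nat.mod_eq_of_lt (hp.pos_lt (s.reg rIdx))]
  exact ⟨div_perWord_lt_arraySize hi arr, trivial, rfl⟩

theorem put_wp (hp : Admissible σ r w) (hs : Params σ r w s) {arr : Fin 3}
    (hi : s.reg rIdx < σ ^ r) (hc : s.reg rVal < σ) :
    WP w (arraySize σ r w) (put arr) (fun t s' => t = 10 ∧
      tables σ w s' = setEntry (tables σ w s) arr (s.reg rIdx) (s.reg rVal)) s := by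
  have hwidth : s.reg rVal < 2 ^ Nat.clog 2 σ := hc.trans_le (Nat.le_pow_clog one_lt_two σ)
  have hdiff : (getBits (Nat.clog 2 σ) (s.reg rIdx % perWord σ w * Nat.clog 2 σ)
      (s.mem arr (s.reg rIdx / perWord σ w)) ^^^ s.reg rVal)
        <<< (s.reg rIdx % perWord σ w * Nat.clog 2 σ) < 2 ^ w := by
    refine (Nat.shiftLeft_lt (Nat.xor_lt_two_pow (getBits_lt _ _ _) hwidth)).trans_le ?_
    exact Nat.pow_le_pow_right two_pos (by rw [add_comm]; exact hp.pos_add_clog_le _)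
  rw [getBits] at hdiff
  simp only [put, WP.seq_iff, WP.op_iff, WP.load_iff, WP.store_iff, BinOp.eval, State.reg_setReg,
    State.mem_setReg, Fin.reduceEq, if_true, if_false, hs.per, hs.bits, hs.mask,
    Nat.mod_eq_of_lt (hp.pos_lt (s.reg rIdx)), Nat.mod_eq_of_lt hdiff]
  exact ⟨div_perWord_lt_arraySize hi arr, div_perWord_lt_arraySize hi arr, trivial,
    tables_setMem s arr (s.reg rIdx) hwidth⟩

end

/-! ### Initialization -/

section

variable {w : ℕ} {s : State 23 3}

theorem computeBits_wp (hp : Admissible σ r w) (hmax : s.reg rMax = σ - 1) (hone : s.reg rOne = 1)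
    (hbits : s.reg rBits = 0) :
    WP w (arraySize σ r w) computeBits
      (fun t s' => t ≤ Nat.clog 2 σ * 3 + 2 ∧ s'.reg rBits = Nat.clog 2 σ) s := by
  rw [computeBits, WP.seq_iff, WP.copy_iff]
  refine (WP.loop (n := Nat.clog 2 σ) (fun n s' => s'.reg rBits + n = Nat.clog 2 σ ∧
    s'.reg rFlag = (σ - 1) >>> s'.reg rBits) 2 ?_ ?_).mono ?_
  · rintro n s' hframe ⟨hn, hflag⟩ hne
    have hmax' : s'.reg rMax = σ - 1 := (hframe.reg_eq rMax rfl).trans hmax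
    have hone' : s'.reg rOne = 1 := (hframe.reg_eq rOne rfl).trans hone
    have hlt : s'.reg rBits < Nat.clog 2 σ := by
      rw [Nat.lt_clog_iff_pow_lt one_lt_two]
      rw [hflag, Nat.shiftRight_eq_div_pow, Nat.div_ne_zero_iff] at hne
      exact hne.2.trans_lt (Nat.sub_lt hp.base_pos one_pos)
    have hword : s'.reg rBits + 1 < 2 ^ w :=
      lt_of_le_of_lt (hlt.trans_le hp.clog_le) Nat.lt_two_pow_self
    simp only [WP.seq_iff, WP.op_iff, BinOp.eval, State.reg_setReg, Fin.reduceEq, if_true, if_false,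
      hmax', hone', Nat.mod_eq_of_lt hword]
    exact ⟨le_rfl, n - 1, by omega, by omega, trivial⟩
  · simp [State.reg_setReg, hmax, hbits]
  · rintro t s' ⟨ht, hzero, n, hn, hflag⟩
    have hle : Nat.clog 2 σ ≤ s'.reg rBits := by
      rw [hzero, eq_comm, Nat.shiftRight_eq_div_pow,
        Nat.div_eq_zero_iff_lt (by positivity)] at hflag
      exact Nat.clog_le_of_le_pow (by omega)
    exact ⟨by omega, by omega⟩

theorem computePow_wp (hp : Admissible σ r w) (hlen : s.reg rLen = r)
    (hsig : s.reg rSig = σ % 2 ^ w) (hone : s.reg rOne = 1) :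
    WP w (arraySize σ r w) computePow
      (fun t s' => t ≤ r * 3 + 3 ∧ s'.reg rTopPow = σ ^ (r - 1)) s := by
  have hr := hp.one_le
  simp only [computePow, WP.seq_iff, WP.copy_iff, WP.op_iff, BinOp.eval]
  refine (WP.loop (n := r - 1) (fun n s' => n < r ∧ s'.reg rFlag = n ∧
    s'.reg rTopPow = σ ^ (r - 1 - n)) 2 ?_ ?_).mono ?_
  · rintro n s' hframe ⟨hn, hflag, hpow⟩ hne
    have hsig' : s'.reg rSig = σ % 2 ^ w := (hframe.reg_eq rSig rfl).trans hsig
    have hone' : s'.reg rOne = 1 := (hframe.reg_eq rOne rfl).trans hone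
    have hflag' : (n + (2 ^ w - 1)) % 2 ^ w = n - 1 := by
      have hn' : n < 2 ^ w := hn.trans hp.len_lt
      simpa [Nat.mod_eq_of_lt hn'] using mod_add_sub_one_mod (hflag ▸ hne) hn'.le
    have hpow' : σ ^ (r - 1 - n) * (σ % 2 ^ w) % 2 ^ w = σ ^ (r - 1 - (n - 1)) := by
      rw [Nat.mul_mod_mod, ← pow_succ, show r - 1 - n + 1 = r - 1 - (n - 1) by omega]
      exact Nat.mod_eq_of_lt (hp.pow_lt (by omega))
    simp only [WP.seq_iff, WP.op_iff, BinOp.eval, State.reg_setReg, Fin.reduceEq, if_true, if_false,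
      hsig', hone', hflag, hpow, hflag', hpow']
    exact ⟨le_rfl, n - 1, by omega, by omega, rfl, rfl⟩
  · have hflag : (r + (2 ^ w - 1)) % 2 ^ w = r - 1 := by
      simpa [Nat.mod_eq_of_lt hp.len_lt] using
        mod_add_sub_one_mod (Nat.one_le_iff_ne_zero.1 hr) hp.len_lt.le
    simp only [State.reg_setReg, Fin.reduceEq, if_true, if_false, hlen, hone, hflag, Nat.sub_self,
      pow_zero, and_true]
    omega
  · rintro t s' ⟨ht, hzero, n, -, hflag, hpow⟩
    obtain rfl : n = 0 := hflag.symm.trans hzero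
    exact ⟨by omega, hpow⟩

theorem setupCmd_wp (hp : Admissible σ r w) (hmax : s.reg rMax = σ - 1) (hlen : s.reg rLen = r)
    (hword : s.reg rWord = w) (hbits : s.reg rBits = 0) :
    WP w (arraySize σ r w) setupCmd
      (fun t s' => t ≤ Nat.clog 2 σ * 3 + r * 3 + 10 ∧ Params σ r w s') s := by
  have hpos := hp.base_pos
  have hone : 1 % 2 ^ w = 1 := Nat.mod_eq_of_lt hp.one_lt
  simp only [setupCmd, WP.seq_iff, WP.const_iff, WP.op_iff, BinOp.eval, State.reg_setReg,
    Fin.reduceEq, if_true, if_false, hmax, hone, Nat.sub_add_cancel hpos]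
  refine (computeBits_wp hp ?_ ?_ ?_).frame.mono ?_
  iterate 3 simp [State.reg_setReg, hmax, hbits]
  rintro t s₁ ⟨⟨ht, hbits₁⟩, hframe₁⟩
  have hone₁ : s₁.reg rOne = 1 := hframe₁.reg_eq rOne rfl
  have hsig₁ : s₁.reg rSig = σ % 2 ^ w := hframe₁.reg_eq rSig rfl
  have hlen₁ : s₁.reg rLen = r := (hframe₁.reg_eq rLen rfl).trans hlen
  have hword₁ : s₁.reg rWord = w := (hframe₁.reg_eq rWord rfl).trans hword
  have hmask : (2 ^ Nat.clog 2 σ % 2 ^ w + (2 ^ w - 1)) % 2 ^ w = 2 ^ Nat.clog 2 σ - 1 :=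
    mod_add_sub_one_mod (by positivity) (Nat.pow_le_pow_right two_pos hp.clog_le)
  simp only [hbits₁, hone₁, hword₁, Nat.one_shiftLeft, hmask]
  refine (computePow_wp hp ?_ ?_ ?_).frame.mono ?_
  iterate 3 simpa [State.reg_setReg]
  rintro t' s₂ ⟨⟨ht', htopPow⟩, hframe₂⟩
  refine ⟨by omega, ?_, ?_, ?_, ?_, ?_, htopPow, ?_⟩
  · exact (hframe₂.reg_eq rLen rfl).trans hlen₁
  · exact (hframe₂.reg_eq rSig rfl).trans hsig₁
  · exact (hframe₂.reg_eq rBits rfl).trans hbits₁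
  · exact hframe₂.reg_eq rMask rfl
  · exact hframe₂.reg_eq rPer rfl
  · exact (hframe₂.reg_eq rOne rfl).trans hone₁

end

/-! ### Insertion of a block -/

section

variable {w : ℕ} {s : State 23 3} {B : Set ℕ} {E : Set (ℕ × ℕ)}

theorem enterNode_wp (hp : Admissible σ r w) (hs : Params σ r w s) {X l : ℕ} (hX : X ∈ B)
    (hl : l < r) (hidx : s.reg rIdx = slot σ l (X % σ ^ l)) (hval : s.reg rVal = X / σ ^ l % σ)
    (htrie : IsTrie σ r (tables σ w s) B E) :
    WP w (arraySize σ r w) enterNode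
      (fun t s' => t = 21 ∧ IsTrie σ r (tables σ w s') B (insert (X, l) E)) s := by
  have hσ := hp.base_pos
  have hslot : slot σ l (X % σ ^ l) < σ ^ r := slot_lt hp.two_le hl (Nat.mod_lt X (by positivity))
  refine WP.seq_frame (put_wp hp hs (hidx ▸ hslot) (hval ▸ Nat.mod_lt _ hσ)) ?_
  rintro _ s₁ ⟨rfl, htables₁⟩ hframe₁
  have hs₁ : Params σ r w s₁ := hs.of_frame hframe₁
  have hidx₁ : s₁.reg rIdx = slot σ l (X % σ ^ l) := (hframe₁.reg_eq rIdx rfl).trans hidx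
  rw [WP.seq_iff, WP.copy_iff, hs₁.one]
  have hidx₂ : (s₁.setReg rVal 1).reg rIdx = slot σ l (X % σ ^ l) := by
    simpa [State.reg_setReg] using hidx₁
  have hval₂ : (s₁.setReg rVal 1).reg rVal = 1 := by simp [State.reg_setReg]
  refine (put_wp hp (hs₁.setReg _) (hidx₂ ▸ hslot) (hval₂ ▸ hp.two_le)).mono ?_
  rintro _ s₂ ⟨rfl, htables₂⟩
  rw [hidx₂, hval₂, show tables σ w (s₁.setReg rVal 1) = tables σ w s₁ from rfl, htables₁, hidx,
    hval] at htables₂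
  exact ⟨rfl, htables₂ ▸ htrie.setNode hp.two_le hX one_ne_zero⟩

theorem insertStep_wp (hp : Admissible σ r w) (hs : Params σ r w s) {X l : ℕ}
    (hX : X ∈ B) (hl : l < r) (hblock : s.reg rBlock = X % σ ^ (l + 1)) (hpow : s.reg rPow = σ ^ l)
    (htrie : IsTrie σ r (tables σ w s) B E) :
    WP w (arraySize σ r w) insertStep (fun t s' => t = 25 ∧ s'.reg rBlock = X % σ ^ l ∧
      s'.reg rPow = σ ^ l / σ ∧ IsTrie σ r (tables σ w s') B (insert (X, l) E)) s := by
  have hσ := hp.base_pos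
  have hval : X % σ ^ (l + 1) / σ ^ l = X / σ ^ l % σ := Nat.mod_mul_right_div_self X (σ ^ l) σ
  have hsuffix : X % σ ^ (l + 1) % σ ^ l = X % σ ^ l := Nat.mod_mul_right_mod X (σ ^ l) σ
  have hidx : (σ ^ l + X % σ ^ l) % 2 ^ w = slot σ l (X % σ ^ l) :=
    Nat.mod_eq_of_lt ((slot_lt hp.two_le hl (Nat.mod_lt X (by positivity))).trans_le hp.pow_le)
  simp only [insertStep, WP.seq_iff, WP.op_iff, BinOp.eval, State.reg_setReg, Fin.reduceEq,
    if_true, if_false, hblock, hpow, hval, hsuffix, hidx]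
  have hs₁ := ((hs.setReg (x := rVal) (X / σ ^ l % σ)).setReg (x := rBlock) (X % σ ^ l)).setReg
    (x := rIdx) (slot σ l (X % σ ^ l))
  refine (enterNode_wp hp hs₁ hX hl ?_ ?_ htrie).frame.mono ?_
  iterate 2 simp [State.reg_setReg]
  rintro _ s₂ ⟨⟨rfl, htrie₂⟩, hframe₂⟩
  have hblock₂ : s₂.reg rBlock = X % σ ^ l := hframe₂.reg_eq rBlock rfl
  have hpow₂ : s₂.reg rPow = σ ^ l := (hframe₂.reg_eq rPow rfl).trans hpow
  simp only [hblock₂, hpow₂, (hs₁.of_frame hframe₂).sig,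
    div_mod_two_pow (hp.pow_lt hl) hp.base_le]
  exact ⟨trivial, trivial, trivial, htrie₂⟩

theorem pow_succ_div_self (hσ : 0 < σ) (l : ℕ) : σ ^ (l + 1) / σ = σ ^ l := by
  rw [pow_succ, Nat.mul_div_cancel _ hσ]

theorem insertLoop_wp (hp : Admissible σ r w) (hs : Params σ r w s) {X : ℕ} (hX : X < σ ^ r)
    (hblock : s.reg rBlock = X) (hpow : s.reg rPow = σ ^ (r - 1))
    (htrie : IsTrie σ r (tables σ w s) (insert X B) (B ×ˢ Set.univ)) :
    WP w (arraySize σ r w) (.loop rPow insertStep) (fun t s' => t ≤ r * 26 + 1 ∧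
      IsTrie σ r (tables σ w s') (insert X B) (insert X B ×ˢ Set.univ)) s := by
  have hσ := hp.base_pos
  refine (WP.loop (n := r) (fun n s' => n ≤ r ∧ s'.reg rBlock = X % σ ^ n ∧
    s'.reg rPow = σ ^ n / σ ∧ IsTrie σ r (tables σ w s') (insert X B)
      (B ×ˢ Set.univ ∪ {X} ×ˢ Set.Ici n)) 25 ?_ ?_).mono ?_
  · rintro n s' hframe ⟨hn, hblock', hpow', htrie'⟩ hne
    obtain _ | l := n
    · exact absurd (hpow'.trans (Nat.div_eq_of_lt hp.two_le)) hne
    rw [pow_succ_div_self hσ] at hpow'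
    refine (insertStep_wp hp (hs.of_frame hframe) (Set.mem_insert X B) hn hblock' hpow'
      htrie').mono ?_
    rintro t s'' ⟨rfl, hblock'', hpow'', htrie''⟩
    refine ⟨le_rfl, l, l.lt_succ_self, by omega, hblock'', hpow'', htrie''.mono fun Y l' hY _ => ?_⟩
    simp only [Set.mem_union, Set.mem_prod, Set.mem_insert_iff, Set.mem_singleton_iff,
      Set.mem_univ, Set.mem_Ici, Prod.mk.injEq] at hY ⊢
    grind
  · refine ⟨le_rfl, by rw [hblock, Nat.mod_eq_of_lt hX], ?_, htrie.mono fun Y l hY hl => ?_⟩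
    · rw [hpow, ← pow_succ_div_self hσ, Nat.sub_add_cancel hp.one_le]
    · simp only [Set.mem_union, Set.mem_prod, Set.mem_singleton_iff, Set.mem_univ,
        Set.mem_Ici] at hY ⊢
      grind
  · rintro t s' ⟨ht, hzero, n, -, -, hpow', htrie'⟩
    have hn : n = 0 := by
      by_contra hn
      rw [hzero, ← Nat.succ_pred hn, Nat.succ_eq_add_one, pow_succ_div_self hσ] at hpow'
      exact (by positivity : σ ^ n.pred ≠ 0) hpow'.symm
    refine ⟨ht, htrie'.mono fun Y l hY _ => ?_⟩
    simp only [hn, Set.mem_union, Set.mem_prod, Set.mem_insert_iff, Set.mem_singleton_iff,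
      Set.mem_univ, Set.mem_Ici] at hY ⊢
    grind

theorem insertCmd_wp (hp : Admissible σ r w) (hs : Params σ r w s) (hcur : s.reg rCur < σ ^ r)
    (htrie : IsTrie σ r (tables σ w s) B (B ×ˢ Set.univ)) :
    WP w (arraySize σ r w) insertCmd (fun t s' => t ≤ r * 26 + 15 ∧ IsTrie σ r (tables σ w s')
      (insert (s.reg rCur) B) (insert (s.reg rCur) B ×ˢ Set.univ)) s := by
  simp only [insertCmd, WP.seq_iff, WP.copy_iff, State.reg_setReg, Fin.reduceEq, if_false, hs.one]
  have hs₁ := (hs.setReg (x := rIdx) (s.reg rCur)).setReg (x := rVal) 1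
  refine (put_wp hp hs₁ ?_ ?_).frame.mono ?_
  · simpa [State.reg_setReg] using hcur
  · simpa [State.reg_setReg] using Nat.lt_of_succ_le hp.two_le
  rintro _ s₂ ⟨⟨rfl, htables₂⟩, hframe₂⟩
  have hcur₂ : s₂.reg rCur = s.reg rCur := hframe₂.reg_eq rCur rfl
  have hs₂ : Params σ r w s₂ := hs₁.of_frame hframe₂
  have htrie₂ : IsTrie σ r (tables σ w s₂) (insert (s.reg rCur) B) (B ×ˢ Set.univ) := by
    rw [htables₂]
    exact htrie.setLeaf (s.reg rCur) one_ne_zero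
  refine (insertLoop_wp hp ((hs₂.setReg _).setReg _) hcur ?_ ?_ htrie₂).mono ?_
  · simpa [State.reg_setReg] using hcur₂
  · simp [State.reg_setReg, hs₂.topPow]
  · rintro t s' ⟨ht, htrie'⟩
    exact ⟨by omega, htrie'⟩

theorem flushCmd_wp (hp : Admissible σ r w) (hs : Params σ r w s) (hcur : s.reg rCur < σ ^ r)
    (htrie : IsTrie σ r (tables σ w s) B (B ×ˢ Set.univ)) :
    WP w (arraySize σ r w) flushCmd (fun t s' => t ≤ r * 26 + 17 ∧ s'.reg rCur = 0 ∧
      s'.reg rCnt = 0 ∧ IsTrie σ r (tables σ w s')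
        (insert (s.reg rCur) B) (insert (s.reg rCur) B ×ˢ Set.univ)) s := by
  rw [flushCmd, WP.seq_iff]
  refine (insertCmd_wp hp hs hcur htrie).mono ?_
  rintro t s' ⟨ht, htrie'⟩
  simp only [WP.seq_iff, WP.const_iff, State.reg_setReg, Fin.reduceEq, if_true, if_false,
    Nat.zero_mod]
  exact ⟨by omega, trivial, trivial, htrie'⟩

end

/-! ### Search for the longest suffix -/

section

variable {w : ℕ} {s : State 23 3} {B : Set ℕ}

theorem testNode_wp (hp : Admissible σ r w) (hs : Params σ r w s)
    (htrie : IsTrie σ r (tables σ w s) B (B ×ˢ Set.univ)) {l : ℕ} (hl : l < r)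
    (hpow : s.reg rPow = σ ^ l) (hblock : s.reg rBlock < σ ^ l) :
    WP w (arraySize σ r w) testNode (fun t s' => t = 9 ∧
      (s'.reg rFlag = 0 ↔ l = 0 ∨ ∃ X ∈ B, X % σ ^ l = s.reg rBlock)) s := by
  have hslot : slot σ l (s.reg rBlock) < σ ^ r := slot_lt hp.two_le hl hblock
  have hidx : (σ ^ l + s.reg rBlock) % 2 ^ w = slot σ l (s.reg rBlock) :=
    Nat.mod_eq_of_lt (hslot.trans_le hp.pow_le)
  simp only [testNode, WP.seq_iff, WP.op_iff, BinOp.eval, hpow, hidx]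
  have hs₁ := hs.setReg (x := rIdx) (slot σ l (s.reg rBlock))
  refine (fetch_wp hp hs₁ (by simpa [State.reg_setReg] using hslot)).frame.mono ?_
  rintro _ s₂ ⟨⟨rfl, hval⟩, hframe⟩
  have hval₂ : s₂.reg rVal = tables σ w s nodeArr (slot σ l (s.reg rBlock)) := hval
  have hpow₂ : s₂.reg rPow = σ ^ l := (hframe.reg_eq rPow rfl).trans hpow
  have hone : 1 % 2 ^ w = 1 := Nat.mod_eq_of_lt hp.one_lt
  have hone_lt : 1 < σ ^ l ↔ l ≠ 0 :=
    ⟨fun h hl => by simp [hl] at h, fun h => Nat.one_lt_pow h hp.two_le⟩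
  rw [← htrie.node_ne_zero_iff hl hblock]
  simp only [State.reg_setReg, Fin.reduceEq, if_true, if_false, (hs₁.of_frame hframe).one, hpow₂,
    hval₂, hone]
  grind

/-- The registers hold the prefix of `A` of length `r - d`, and no longer prefix of `A` is a suffix
of a string in `B`. The register `rPow` is not set when `d = 0`, since `σ ^ r` need not fit into a
word. -/
structure Candidate (σ r : ℕ) (B : Set ℕ) (A d : ℕ) (s : State 23 3) : Prop where
  le : d ≤ r
  shift : s.reg rShift = d
  block : s.reg rBlock = A / σ ^ d
  pow : d ≠ 0 → s.reg rPow = σ ^ (r - d)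
  not_overlap : ∀ X ∈ B, ∀ d' < d, ¬ Overlap σ r d' X A

theorem Candidate.testNode_wp {A d : ℕ} (h : Candidate σ r B A d s) (hp : Admissible σ r w)
    (hs : Params σ r w s) (htrie : IsTrie σ r (tables σ w s) B (B ×ˢ Set.univ)) (hA : A < σ ^ r)
    (hd : d ≠ 0) :
    WP w (arraySize σ r w) testNode (fun t s' => t = 9 ∧ Candidate σ r B A d s' ∧
      (s'.reg rFlag = 0 ↔ d = r ∨ ∃ X ∈ B, Overlap σ r d X A)) s := by
  have hle := h.le
  have hprefix : A / σ ^ d < σ ^ (r - d) := by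
    rw [Nat.div_lt_iff_lt_mul (by have := hp.base_pos; positivity), ← pow_add,
      Nat.sub_add_cancel hle]
    exact hA
  refine (MetaBlock.testNode_wp hp hs htrie (by omega) (h.pow hd) (h.block ▸ hprefix)).frame.mono ?_
  rintro t s' ⟨⟨ht, hflag⟩, hframe⟩
  refine ⟨ht, ⟨hle, ?_, ?_, fun _ => ?_, h.not_overlap⟩, ?_⟩
  · exact (hframe.reg_eq rShift rfl).trans h.shift
  · exact (hframe.reg_eq rBlock rfl).trans h.block
  · exact (hframe.reg_eq rPow rfl).trans (h.pow hd)
  · rw [hflag, h.block, show r - d = 0 ↔ d = r by omega]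
    rfl

theorem shortenStep_wp (hp : Admissible σ r w) (hs : Params σ r w s)
    (htrie : IsTrie σ r (tables σ w s) B (B ×ˢ Set.univ)) {A d : ℕ} (hA : A < σ ^ r) (hd : d ≠ 0)
    (h : Candidate σ r B A d s) (hdr : d < r) (hfail : ¬ ∃ X ∈ B, Overlap σ r d X A) :
    WP w (arraySize σ r w) shortenStep (fun t s' => t = 12 ∧ Candidate σ r B A (d + 1) s' ∧
      (s'.reg rFlag = 0 ↔ d + 1 = r ∨ ∃ X ∈ B, Overlap σ r (d + 1) X A)) s := by
  have hblock : A / σ ^ d / (σ % 2 ^ w) = A / σ ^ (d + 1) := by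
    rw [div_mod_two_pow (((Nat.div_le_self _ _).trans_lt hA).trans_le hp.pow_le) hp.base_le,
      Nat.div_div_eq_div_mul, pow_succ]
  have hpow : σ ^ (r - d) / (σ % 2 ^ w) = σ ^ (r - (d + 1)) := by
    rw [div_mod_two_pow (hp.pow_lt (by omega)) hp.base_le,
      show r - d = r - (d + 1) + 1 by omega, pow_succ_div_self hp.base_pos]
  have hshift : (d + 1) % 2 ^ w = d + 1 := Nat.mod_eq_of_lt (by have := hp.len_lt; omega)
  simp only [shortenStep, WP.seq_iff, WP.op_iff, BinOp.eval, State.reg_setReg, Fin.reduceEq,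
    if_false, hs.sig, hs.one, h.block, h.pow hd, h.shift, hblock, hpow, hshift]
  have hs₁ := ((hs.setReg (x := rBlock) (A / σ ^ (d + 1))).setReg (x := rPow)
    (σ ^ (r - (d + 1)))).setReg (x := rShift) (d + 1)
  refine (Candidate.testNode_wp ⟨hdr, ?_, ?_, fun _ => ?_, ?_⟩ hp hs₁ htrie hA d.succ_ne_zero).mono
    ?_
  iterate 3 simp [State.reg_setReg]
  · intro X hX d' hd'
    rcases Nat.lt_succ_iff_lt_or_eq.1 hd' with hlt | rfl
    · exact h.not_overlap X hX d' hlt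
    · exact fun hoverlap => hfail ⟨X, hX, hoverlap⟩
  · rintro t s' ⟨rfl, hpost⟩
    exact ⟨rfl, hpost⟩

theorem overlap_self {A : ℕ} (hA : A < σ ^ r) (X : ℕ) : Overlap σ r r X A := by
  rw [Overlap, Nat.sub_self, pow_zero, Nat.mod_one, Nat.div_eq_of_lt hA]

theorem searchLoop_wp (hp : Admissible σ r w) (hs : Params σ r w s)
    (htrie : IsTrie σ r (tables σ w s) B (B ×ˢ Set.univ)) {A : ℕ} (hA : A < σ ^ r)
    (h : Candidate σ r B A 1 s)
    (hflag : s.reg rFlag = 0 ↔ 1 = r ∨ ∃ X ∈ B, Overlap σ r 1 X A) :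
    WP w (arraySize σ r w) (.loop rFlag shortenStep) (fun t s' => t ≤ r * 13 + 1 ∧
      ∃ d, Candidate σ r B A d s' ∧ (B.Nonempty → ∃ X ∈ B, Overlap σ r d X A)) s := by
  refine (WP.loop (n := r) (fun n s' => ∃ d, d ≠ 0 ∧ n + d = r + 1 ∧
    Candidate σ r B A d s' ∧ (s'.reg rFlag = 0 ↔ d = r ∨ ∃ X ∈ B, Overlap σ r d X A))
    12 ?_ ?_).mono ?_
  · rintro n s' hframe ⟨d, hd, hn, h', hflag'⟩ hne
    rw [Ne, hflag', not_or] at hne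
    have hdr : d < r := h'.le.lt_of_ne hne.1
    have htrie' : IsTrie σ r (tables σ w s') B (B ×ˢ Set.univ) := by
      rwa [tables_of_frame hframe rfl]
    refine (shortenStep_wp hp (hs.of_frame hframe) htrie' hA hd h' hdr hne.2).mono ?_
    rintro t s'' ⟨rfl, hpost⟩
    exact ⟨le_rfl, n - 1, by omega, d + 1, d.succ_ne_zero, by omega, hpost⟩
  · exact ⟨1, one_ne_zero, rfl, h, hflag⟩
  · rintro t s' ⟨ht, hzero, _, d, -, -, h', hflag'⟩
    refine ⟨ht, d, h', fun ⟨X, hX⟩ => ?_⟩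
    obtain rfl | hfound := hflag'.1 hzero
    · exact ⟨X, hX, overlap_self hA X⟩
    · exact hfound

theorem searchCmd_wp (hp : Admissible σ r w) (hs : Params σ r w s)
    (htrie : IsTrie σ r (tables σ w s) B (B ×ˢ Set.univ)) {A : ℕ} (hA : A < σ ^ r)
    (harg : s.reg rArg = A) (hAB : A ∉ B) (hB : ∀ X ∈ B, X < σ ^ r) :
    WP w (arraySize σ r w) searchCmd (fun t s' => t ≤ r * 13 + 13 ∧
      ∃ d, Candidate σ r B A d s' ∧ (B.Nonempty → ∃ X ∈ B, Overlap σ r d X A)) s := by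
  simp only [searchCmd, WP.seq_iff, WP.op_iff, WP.copy_iff, BinOp.eval, State.reg_setReg,
    Fin.reduceEq, if_false, hs.sig, hs.one, hs.topPow, harg,
    div_mod_two_pow (hA.trans_le hp.pow_le) hp.base_le]
  have hs₁ := ((hs.setReg (x := rBlock) (A / σ)).setReg (x := rPow) (σ ^ (r - 1))).setReg
    (x := rShift) 1
  refine (Candidate.testNode_wp ⟨hp.one_le, ?_, ?_, fun _ => ?_, ?_⟩ hp hs₁ htrie hA
    one_ne_zero).frame.mono ?_
  iterate 3 simp [State.reg_setReg]
  · intro X hX d hd hoverlap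
    obtain rfl := Nat.lt_one_iff.1 hd
    rw [Overlap, Nat.sub_zero, pow_zero, Nat.div_one, Nat.mod_eq_of_lt (hB X hX)] at hoverlap
    exact hAB (hoverlap ▸ hX)
  rintro _ s₂ ⟨⟨rfl, h₂, hflag₂⟩, hframe₂⟩
  have htrie₂ : IsTrie σ r (tables σ w s₂) B (B ×ˢ Set.univ) := by
    rwa [tables_of_frame hframe₂ rfl]
  refine (searchLoop_wp hp (hs₁.of_frame hframe₂) htrie₂ hA h₂ hflag₂).mono ?_
  rintro t s' ⟨ht, hpost⟩
  exact ⟨by omega, hpost⟩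

end

/-! ### Extension to a block -/

section

variable {w : ℕ} {s : State 23 3} {B : Set ℕ}

theorem extendStep_wp (hp : Admissible σ r w) (hs : Params σ r w s) {l : ℕ} (hl : l < r)
    (hpow : s.reg rPow = σ ^ l) (hblock : s.reg rBlock < σ ^ l) (hflag : s.reg rFlag = r - l)
    (hchar : tables σ w s charArr (slot σ l (s.reg rBlock)) < σ) :
    WP w (arraySize σ r w) extendStep (fun t s' => t = 11 ∧ s'.reg rFlag = r - (l + 1) ∧
      s'.reg rPow = σ ^ (l + 1) % 2 ^ w ∧ s'.reg rBlock =
        s.reg rBlock + σ ^ l * tables σ w s charArr (slot σ l (s.reg rBlock))) s := by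
  set x := s.reg rBlock with hx
  set c := tables σ w s charArr (slot σ l x)
  have hslot : slot σ l x < σ ^ r := slot_lt hp.two_le hl hblock
  have hidx : (σ ^ l + x) % 2 ^ w = slot σ l x := Nat.mod_eq_of_lt (hslot.trans_le hp.pow_le)
  simp only [extendStep, WP.seq_iff, WP.op_iff, BinOp.eval, hpow, ← hx, hidx]
  have hs₁ := hs.setReg (x := rIdx) (slot σ l x)
  refine (fetch_wp hp hs₁ (by simpa [State.reg_setReg] using hslot)).frame.mono ?_
  rintro _ s₂ ⟨⟨rfl, hval⟩, hframe⟩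
  have hval₂ : s₂.reg rVal = c := hval
  have hs₂ : Params σ r w s₂ := hs₁.of_frame hframe
  have hpow₂ : s₂.reg rPow = σ ^ l := (hframe.reg_eq rPow rfl).trans hpow
  have hblock₂ : s₂.reg rBlock = x := hframe.reg_eq rBlock rfl
  have hflag₂ : s₂.reg rFlag = r - l := (hframe.reg_eq rFlag rfl).trans hflag
  have hsum : x + σ ^ l * c < 2 ^ w :=
    calc x + σ ^ l * c < σ ^ l * (c + 1) := by rw [Nat.mul_succ]; omega
      _ ≤ σ ^ l * σ := Nat.mul_le_mul_left _ hchar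
      _ ≤ σ ^ r := by rw [← pow_succ]; exact Nat.pow_le_pow_right hp.base_pos hl
      _ ≤ 2 ^ w := hp.pow_le
  have hcnt : (r - l + (2 ^ w - 1)) % 2 ^ w = r - (l + 1) := by
    have hlt : r - l < 2 ^ w := (Nat.sub_le r l).trans_lt hp.len_lt
    simpa [Nat.mod_eq_of_lt hlt, Nat.sub_sub] using
      mod_add_sub_one_mod (Nat.sub_ne_zero_of_lt hl) hlt.le
  simp only [State.reg_setReg, Fin.reduceEq, if_true, if_false, hval₂, hpow₂, hblock₂, hflag₂,
    hs₂.sig, hs₂.one, hcnt, Nat.add_mod_mod, Nat.mul_mod_mod, Nat.mod_eq_of_lt hsum, pow_succ,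
    Nat.reduceAdd, and_self]

/-- The register `rBlock` holds a string of length `l` with a suffix of length `m` of code `x`; it
is a suffix of a string in `B`, unless `B` is empty. -/
structure Extension (σ r : ℕ) (B : Set ℕ) (m x l : ℕ) (s : State 23 3) : Prop where
  le : l ≤ r
  ge : m ≤ l
  flag : s.reg rFlag = r - l
  pow : l < r → s.reg rPow = σ ^ l
  lt : s.reg rBlock < σ ^ l
  mod_pow : s.reg rBlock % σ ^ m = x
  exists_mod_pow : B.Nonempty → ∃ X ∈ B, X % σ ^ l = s.reg rBlock

theorem Extension.step_wp {m x l : ℕ} (h : Extension σ r B m x l s) (hl : l < r)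
    (hp : Admissible σ r w) (hs : Params σ r w s)
    (htrie : IsTrie σ r (tables σ w s) B (B ×ˢ Set.univ)) :
    WP w (arraySize σ r w) extendStep
      (fun t s' => t = 11 ∧ Extension σ r B m x (l + 1) s') s := by
  have hchar := htrie.char_lt (slot σ l (s.reg rBlock))
  refine (extendStep_wp hp hs hl (h.pow hl) h.lt h.flag hchar).mono ?_
  rintro t s' ⟨ht, hflag', hpow', hblock'⟩
  refine ⟨ht, hl, h.ge.trans l.le_succ, hflag', fun hl' => ?_, ?_, ?_, fun hB => ?_⟩
  · rw [hpow', Nat.mod_eq_of_lt (hp.pow_lt hl')]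
  · calc s'.reg rBlock
        < σ ^ l * (tables σ w s charArr (slot σ l (s.reg rBlock)) + 1) := by
          rw [hblock', Nat.mul_succ, add_comm]; exact Nat.add_lt_add_left h.lt _
      _ ≤ σ ^ (l + 1) := Nat.mul_le_mul_left _ hchar
  · rw [hblock', Nat.add_mod, Nat.mod_eq_zero_of_dvd ((pow_dvd_pow σ h.ge).mul_right _), add_zero,
      Nat.mod_mod, h.mod_pow]
  · rw [hblock']
    exact htrie.exists_mod_pow_succ_eq hl h.lt (h.exists_mod_pow hB)

theorem extendLoop_wp (hp : Admissible σ r w) (hs : Params σ r w s)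
    (htrie : IsTrie σ r (tables σ w s) B (B ×ˢ Set.univ)) (hB : ∀ X ∈ B, X < σ ^ r) {m : ℕ}
    (h : Extension σ r B m (s.reg rBlock) m s) :
    WP w (arraySize σ r w) (.loop rFlag extendStep) (fun t s' => t ≤ r * 12 + 1 ∧
      s'.reg rBlock % σ ^ m = s.reg rBlock ∧ (B.Nonempty → s'.reg rBlock ∈ B)) s := by
  refine (WP.loop (n := r - m) (fun n s' => ∃ l, l + n = r ∧
    Extension σ r B m (s.reg rBlock) l s') 11 ?_ ?_).mono ?_
  · rintro n s' hframe ⟨l, hn, h'⟩ hne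
    rw [h'.flag] at hne
    have htrie' : IsTrie σ r (tables σ w s') B (B ×ˢ Set.univ) := by
      rwa [tables_of_frame hframe rfl]
    refine (h'.step_wp (by omega) hp (hs.of_frame hframe) htrie').mono ?_
    rintro t s'' ⟨rfl, h''⟩
    exact ⟨le_rfl, n - 1, by omega, l + 1, by omega, h''⟩
  · exact ⟨m, Nat.add_sub_cancel' h.le, h⟩
  · rintro t s' ⟨ht, hzero, _, l, -, h'⟩
    obtain rfl : l = r := le_antisymm h'.le (Nat.sub_eq_zero_iff_le.1 (h'.flag ▸ hzero))
    refine ⟨ht.trans (by gcongr; omega), h'.mod_pow, fun hne => ?_⟩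
    obtain ⟨X, hX, hXblock⟩ := h'.exists_mod_pow hne
    rwa [← hXblock, Nat.mod_eq_of_lt (hB X hX)]

theorem Candidate.extension {A d : ℕ} (h : Candidate σ r B A d s) (hA : A < σ ^ r)
    (hσ : 0 < σ) (hB : B.Nonempty → ∃ X ∈ B, Overlap σ r d X A) :
    Extension σ r B (r - d) (s.reg rBlock) (r - d) (s.setReg rFlag d) := by
  have hlt : s.reg rBlock < σ ^ (r - d) := by
    rw [h.block, Nat.div_lt_iff_lt_mul (by positivity), ← pow_add, Nat.sub_add_cancel h.le]
    exact hA
  refine ⟨Nat.sub_le r d, le_rfl, ?_, fun hl => h.pow (by omega), hlt, Nat.mod_eq_of_lt hlt,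
    fun hne => ?_⟩
  · simp [State.reg_setReg, Nat.sub_sub_self h.le]
  · obtain ⟨X, hX, hoverlap⟩ := hB hne
    exact ⟨X, hX, hoverlap.trans h.block.symm⟩

end

/-! ### Queries -/

/-- The registers hold a correct answer to the query `A`. -/
structure Answer (σ r : ℕ) (B : Set ℕ) (A : ℕ) (s : State 23 3) : Prop where
  shift_le : s.reg rShift ≤ r
  not_overlap : ∀ X ∈ B, ∀ d < s.reg rShift, ¬ Overlap σ r d X A
  block_mem : B.Nonempty → s.reg rBlock ∈ B
  overlap : Overlap σ r (s.reg rShift) (s.reg rBlock) A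

section

variable {w : ℕ} {s : State 23 3} {B : Set ℕ}

theorem Candidate.extend_wp {A d : ℕ} (h : Candidate σ r B A d s) (hp : Admissible σ r w)
    (hs : Params σ r w s) (htrie : IsTrie σ r (tables σ w s) B (B ×ˢ Set.univ))
    (hB : ∀ X ∈ B, X < σ ^ r) (hA : A < σ ^ r)
    (hfound : B.Nonempty → ∃ X ∈ B, Overlap σ r d X A) :
    WP w (arraySize σ r w) extendCmd
      (fun t s' => t ≤ r * 12 + 2 ∧ Answer σ r B A s') s := by
  rw [extendCmd, WP.seq_iff, WP.copy_iff, h.shift]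
  have hext := h.extension hA hp.base_pos hfound
  refine (extendLoop_wp hp (hs.setReg _) htrie hB hext).frame.mono ?_
  rintro t s' ⟨⟨ht, hmod, hmem⟩, hframe⟩
  have hshift' : s'.reg rShift = d := (hframe.reg_eq rShift rfl).trans h.shift
  refine ⟨by omega, hshift' ▸ h.le, hshift' ▸ h.not_overlap, hmem, ?_⟩
  rw [hshift']
  exact hmod.trans h.block

theorem queryCmd_wp (hp : Admissible σ r w) (hs : Params σ r w s)
    (htrie : IsTrie σ r (tables σ w s) B (B ×ˢ Set.univ)) (hB : ∀ X ∈ B, X < σ ^ r)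
    (harg : s.reg rArg < σ ^ r) :
    WP w (arraySize σ r w) queryCmd
      (fun t s' => t ≤ r * 25 + 24 ∧ Answer σ r B (s.reg rArg) s') s := by
  set A := s.reg rArg with hA
  simp only [queryCmd, WP.seq_iff, WP.copy_iff, State.reg_setReg, Fin.reduceEq, if_false, ← hA]
  have hs₁ := (hs.setReg (x := rBlock) A).setReg (x := rIdx) A
  refine (fetch_wp hp hs₁ (by simpa [State.reg_setReg] using harg)).frame.mono ?_
  rintro _ s₂ ⟨⟨rfl, hval⟩, hframe₂⟩
  have hs₂ : Params σ r w s₂ := hs₁.of_frame hframe₂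
  have harg₂ : s₂.reg rArg = A := hframe₂.reg_eq rArg rfl
  have hblock₂ : s₂.reg rBlock = A := hframe₂.reg_eq rBlock rfl
  have htrie₂ : IsTrie σ r (tables σ w s₂) B (B ×ˢ Set.univ) := by
    rwa [tables_of_frame hframe₂ rfl]
  have hleaf : s₂.reg rVal ≠ 0 ↔ A ∈ B := by
    rw [hval]
    exact htrie.leaf_ne_zero_iff A
  refine WP.ite (fun hne => ?_) (fun hzero => ?_)
  · have hmem : A ∈ B := hleaf.1 hne
    rw [WP.const_iff, Nat.zero_mod]
    have h₃ : Candidate σ r B A 0 (s₂.setReg rShift 0) :=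
      ⟨Nat.zero_le r, rfl, by simpa [State.reg_setReg] using hblock₂, by simp, by simp⟩
    refine (h₃.extend_wp hp (hs₂.setReg _) htrie₂ hB harg fun _ => ⟨A, hmem, ?_⟩).mono ?_
    · simp [Overlap, Nat.mod_eq_of_lt harg]
    · rintro t s' ⟨ht, hanswer⟩
      exact ⟨by omega, hanswer⟩
  · have hmem : A ∉ B := fun hmem => hleaf.2 hmem hzero
    refine (searchCmd_wp hp hs₂ htrie₂ harg harg₂ hmem hB).frame.mono ?_
    rintro t₃ s₃ ⟨⟨ht₃, d, h₃, hfound⟩, hframe₃⟩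
    have htrie₃ : IsTrie σ r (tables σ w s₃) B (B ×ˢ Set.univ) := by
      rwa [tables_of_frame hframe₃ rfl]
    refine (h₃.extend_wp hp (hs₂.of_frame hframe₃) htrie₃ hB harg hfound).mono ?_
    rintro t s' ⟨ht, hanswer⟩
    exact ⟨by omega, hanswer⟩

end

/-! ### The invariant of the data structure -/

/-- The state of the data structure after the first `k` characters of `S`. -/
structure Invariant (σ r w : ℕ) (S : Fin N → Fin σ) (k : ℕ) (s : State 23 3) : Prop where
  params : Params σ r w s
  cur : s.reg rCur = substrCode S (k / r * r) (k % r)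
  cnt : s.reg rCnt = k % r
  isTrie : IsTrie σ r (tables σ w s) (blockCodes S r k) (blockCodes S r k ×ˢ Set.univ)

section

variable {k w T : ℕ} {s : State 23 3} {S : Fin N → Fin σ}

theorem setup_invariant (hp : Admissible σ r w) (S : Fin N → Fin σ) :
    WP w (arraySize σ r w) setupCmd
      (fun t s' => t ≤ Nat.clog 2 σ * 3 + r * 3 + 10 ∧ Invariant σ r w S 0 s')
      (trieStructure.start σ r w) := by
  refine (setupCmd_wp hp rfl rfl rfl rfl).frame.mono ?_
  rintro t s ⟨⟨ht, hs⟩, hframe⟩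
  refine ⟨ht, hs, ?_, ?_, ?_⟩
  · rw [Nat.zero_mod, substrCode]
    exact hframe.reg_eq rCur rfl
  · rw [Nat.zero_mod]
    exact hframe.reg_eq rCnt rfl
  · have htables : tables σ w s = fun _ _ => 0 := by
      rw [tables_of_frame hframe rfl]
      ext arr i
      exact field_zero _ _ i
    simpa [htables, blockCodes_zero] using IsTrie.empty hp.base_pos

theorem Invariant.query_wp (h : Invariant σ r w S k s) (hp : Admissible σ r w)
    (A : Fin r → Fin σ) :
    WP w (arraySize σ r w) queryCmd (fun t s' => t ≤ r * 25 + 24 ∧ Invariant σ r w S k s' ∧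
      Answer σ r (blockCodes S r k) (code A) s') (s.setReg rArg (code A)) := by
  have harg : (s.setReg rArg (code A)).reg rArg < σ ^ r := code_lt hp.base_pos A
  refine (MetaBlock.queryCmd_wp hp (h.params.setReg _) h.isTrie
    (fun X hX => lt_of_mem_blockCodes hp.base_pos hX) harg).frame.mono ?_
  rintro t s' ⟨⟨ht, hanswer⟩, hframe⟩
  refine ⟨ht, ⟨(h.params.setReg _).of_frame hframe, ?_, ?_, ?_⟩, hanswer⟩
  · exact (hframe.reg_eq rCur rfl).trans h.cur
  · exact (hframe.reg_eq rCnt rfl).trans h.cnt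
  · rw [tables_of_frame hframe rfl]
    exact h.isTrie

theorem invariant_succ_of_lt (hs : Params σ r w s) (hk : k % r + 1 < r)
    (hcur : s.reg rCur = substrCode S (k / r * r) (k % r + 1)) (hcnt : s.reg rCnt = k % r + 1)
    (htrie : IsTrie σ r (tables σ w s) (blockCodes S r k) (blockCodes S r k ×ˢ Set.univ)) :
    Invariant σ r w S (k + 1) s := by
  have hmod : (k + 1) % r = k % r + 1 := by rw [← Nat.mod_add_mod, Nat.mod_eq_of_lt hk]
  have hdvd : ¬ r ∣ k + 1 := by
    rw [Nat.dvd_iff_mod_eq_zero, hmod]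
    exact Nat.succ_ne_zero _
  refine ⟨hs, ?_, hcnt.trans hmod.symm, ?_⟩
  · rw [hcur, hmod, Nat.succ_div_of_not_dvd hdvd]
  · rwa [blockCodes_succ_of_not_dvd S hdvd]

theorem invariant_succ_of_eq (hs : Params σ r w s) (hk : k % r + 1 = r) (hcur : s.reg rCur = 0)
    (hcnt : s.reg rCnt = 0) {B : Set ℕ}
    (hB : B = insert (substrCode S (k / r * r) r) (blockCodes S r k))
    (htrie : IsTrie σ r (tables σ w s) B (B ×ˢ Set.univ)) : Invariant σ r w S (k + 1) s := by
  have hmod : (k + 1) % r = 0 := by rw [← Nat.mod_add_mod, hk, Nat.mod_self]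
  refine ⟨hs, ?_, hcnt.trans hmod.symm, ?_⟩
  · rw [hcur, hmod, substrCode]
  · rwa [blockCodes_succ_of_dvd S (Nat.dvd_of_mod_eq_zero hmod), ← hB]

theorem Invariant.append_wp (h : Invariant σ r w S k s) (hp : Admissible σ r w) (hk : k < N) :
    WP w (arraySize σ r w) appendCmd
      (fun t s' => t ≤ r * 26 + 22 ∧ Invariant σ r w S (k + 1) s')
      (s.setReg rChar (S ⟨k, hk⟩)) := by
  have hmod : k % r < r := Nat.mod_lt k hp.one_le
  have hcode := substrCode_lt hp.base_pos S (k / r * r) (k % r + 1)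
  have hcur : substrCode S (k / r * r) (k % r) * σ + S ⟨k, hk⟩ =
      substrCode S (k / r * r) (k % r + 1) := by
    rw [substrCode, Nat.div_add_mod', charAt_of_lt S hk]
  have hcode_le : substrCode S (k / r * r) (k % r + 1) < σ ^ r :=
    hcode.trans_le (Nat.pow_le_pow_right hp.base_pos hmod)
  have hcnt : (k % r + 1) % 2 ^ w = k % r + 1 := Nat.mod_eq_of_lt (by have := hp.len_lt; omega)
  simp only [appendCmd, WP.seq_iff, WP.op_iff, BinOp.eval, State.reg_setReg, Fin.reduceEq, if_true,
    if_false, h.params.sig, h.params.one, h.params.len, h.cur, h.cnt, Nat.mul_mod_mod,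
    Nat.mod_add_mod, hcur, hcnt, Nat.mod_eq_of_lt (hcode_le.trans_le hp.pow_le)]
  set s₁ := (((((s.setReg rChar _).setReg rCur _).setReg rCur _).setReg rCnt _).setReg rFlag _)
    with hs₁
  have hparams₁ : Params σ r w s₁ := ((((h.params.setReg _).setReg _).setReg _).setReg _).setReg _
  have hcur₁ : s₁.reg rCur = substrCode S (k / r * r) (k % r + 1) := by
    simp [hs₁, State.reg_setReg]
  have hflag₁ : s₁.reg rFlag ≠ 0 ↔ k % r + 1 = r := by
    simp [hs₁, State.reg_setReg, Nat.mod_eq_of_lt hp.one_lt]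
  refine WP.ite (fun hne => ?_) (fun hzero => ?_)
  · have hr : k % r + 1 = r := hflag₁.1 hne
    refine (flushCmd_wp hp hparams₁ (hcur₁ ▸ hcode_le) h.isTrie).frame.mono ?_
    rintro t s' ⟨⟨ht, hcur', hcnt', htrie'⟩, hframe⟩
    refine ⟨by omega, invariant_succ_of_eq (hparams₁.of_frame hframe) hr hcur' hcnt' ?_ htrie'⟩
    rw [hcur₁, hr]
  · have hr : k % r + 1 ≠ r := fun hr => hflag₁.2 hr hzero
    rw [WP.skip_iff]
    refine ⟨by omega, invariant_succ_of_lt hparams₁ (by omega) hcur₁ ?_ h.isTrie⟩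
    simp [hs₁, State.reg_setReg]

theorem reach_invariant (hp : Admissible σ r w)
    (h : trieStructure.Reach w (arraySize σ r w) r S k s T) :
    k ≤ N ∧ Invariant σ r w S k s ∧
      T ≤ Nat.clog 2 σ * 3 + r * 3 + 10 + k * (r * 26 + 22) := by
  induction h with
  | setup hexec =>
    obtain ⟨ht, hinv⟩ := (setup_invariant hp S).of_exec hexec
    exact ⟨Nat.zero_le N, hinv, by omega⟩
  | append _ hk hexec ih =>
    obtain ⟨-, hinv, hT⟩ := ih
    obtain ⟨ht, hinv'⟩ := (hinv.append_wp hp hk).of_exec hexec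
    exact ⟨hk, hinv', by rw [add_one_mul]; omega⟩
  | query _ A hexec ih =>
    obtain ⟨hk, hinv, hT⟩ := ih
    obtain ⟨-, hinv', -⟩ := (hinv.query_wp hp A).of_exec hexec
    exact ⟨hk, hinv', hT⟩

theorem Answer.exists_isBlock {A : Fin r → Fin σ} (h : Answer σ r (blockCodes S r k) (code A) s)
    (hσ : 0 < σ) (hr : 0 < r) (hk : k ≤ N) (hrk : r ≤ k) :
    ∃ A' : Fin r → Fin σ, IsBlock S k A' ∧ s.reg rBlock = code A' ∧
      ShiftMatch A' A (s.reg rShift) ∧ (s.reg rShift : ℕ∞) ≤ minOffset S k A := by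
  have hblock := h.block_mem (blockCodes_nonempty S hr hrk)
  obtain ⟨A', hA', hcode⟩ := exists_isBlock_of_mem_blockCodes hσ hk hblock
  refine ⟨A', hA', hcode, ?_, le_minOffset hσ hr hk h.not_overlap⟩
  rw [shiftMatch_iff_overlap hσ h.shift_le, ← hcode]
  exact h.overlap

end

/-! ### Resource bounds -/

section

variable {w : ℕ}

theorem one_le_logb_two (hσ : 2 ≤ σ) : 1 ≤ Real.logb 2 σ := by
  rw [Real.le_logb_iff_rpow_le one_lt_two (by positivity), Real.rpow_one]
  exact_mod_cast hσ

theorem clog_two_le_two_mul_logb (hσ : 2 ≤ σ) : (Nat.clog 2 σ : ℝ) ≤ 2 * Real.logb 2 σ := by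
  have hlog := one_le_logb_two hσ
  have hceil : (Nat.clog 2 σ : ℝ) < Real.logb 2 σ + 1 := by
    rw [← Real.natCeil_logb_natCast]
    exact Nat.ceil_lt_add_one (zero_le_one.trans hlog)
  linarith

theorem Admissible.word_le (h : Admissible σ r w) : w ≤ 2 * perWord σ w * Nat.clog 2 σ := by
  have hbits : 0 < Nat.clog 2 σ := Nat.clog_pos one_lt_two h.two_le
  calc w ≤ perWord σ w * Nat.clog 2 σ + Nat.clog 2 σ := (Nat.lt_div_mul_add hbits).le
    _ = (perWord σ w + 1) * Nat.clog 2 σ := (Nat.succ_mul _ _).symm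
    _ ≤ 2 * perWord σ w * Nat.clog 2 σ := by
      have := h.perWord_pos
      gcongr
      omega

theorem spaceBits_le (hp : Admissible σ r w) :
    (spaceBits 23 w (arraySize σ r w) : ℝ) ≤ 100 * ((σ ^ r : ℕ) * Real.logb 2 σ + w) := by
  have htable : σ ^ r / perWord σ w * w ≤ 2 * (σ ^ r * Nat.clog 2 σ) :=
    calc σ ^ r / perWord σ w * w
        ≤ σ ^ r / perWord σ w * (2 * perWord σ w * Nat.clog 2 σ) :=
          Nat.mul_le_mul_left _ hp.word_le
      _ = 2 * (σ ^ r / perWord σ w * perWord σ w * Nat.clog 2 σ) := by ring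
      _ ≤ 2 * (σ ^ r * Nat.clog 2 σ) := by gcongr; exact Nat.div_mul_le_self _ _
  have hspace : spaceBits 23 w (arraySize σ r w) ≤ 6 * (σ ^ r * Nat.clog 2 σ) + 26 * w := by
    simp only [spaceBits, arraySize, Finset.sum_const, Finset.card_univ, Fintype.card_fin,
      smul_eq_mul]
    linarith
  have hlog := mul_le_mul_of_nonneg_left (clog_two_le_two_mul_logb hp.two_le)
    (Nat.cast_nonneg (α := ℝ) (σ ^ r))
  have hnonneg : 0 ≤ ((σ ^ r : ℕ) : ℝ) * Real.logb 2 σ :=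
    mul_nonneg (Nat.cast_nonneg _) (zero_le_one.trans (one_le_logb_two hp.two_le))
  calc (spaceBits 23 w (arraySize σ r w) : ℝ)
      ≤ 6 * ((σ ^ r : ℕ) * Nat.clog 2 σ) + 26 * w := by exact_mod_cast hspace
    _ ≤ 100 * ((σ ^ r : ℕ) * Real.logb 2 σ + w) := by linarith [Nat.cast_nonneg (α := ℝ) w]

theorem log_time_le_logb_pow (hp : Admissible σ r w) :
    (Nat.clog 2 σ * 3 + r * 29 + 32 : ℝ) ≤ 100 * Real.logb 2 (σ ^ r : ℕ) := by
  have hr : (1 : ℝ) ≤ r := by exact_mod_cast hp.one_le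
  have hlog := one_le_logb_two hp.two_le
  have hclog := clog_two_le_two_mul_logb hp.two_le
  have hlen : (r : ℝ) ≤ r * Real.logb 2 σ := le_mul_of_one_le_right (by positivity) hlog
  have hbase : Real.logb 2 σ ≤ r * Real.logb 2 σ := le_mul_of_one_le_left (by positivity) hr
  rw [Nat.cast_pow, Real.logb_pow]
  linarith

theorem queryTime_le (hp : Admissible σ r w) {t : ℕ} (ht : t ≤ r * 25 + 24) :
    (t : ℝ) ≤ 100 * Real.logb 2 (σ ^ r : ℕ) := by
  refine le_trans ?_ (log_time_le_logb_pow hp)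
  exact_mod_cast (by omega : t ≤ Nat.clog 2 σ * 3 + r * 29 + 32)

theorem updateTime_le (hp : Admissible σ r w) {k T : ℕ} (hk : k ≤ σ ^ r)
    (hT : T ≤ Nat.clog 2 σ * 3 + r * 3 + 10 + k * (r * 26 + 22)) :
    (T : ℝ) ≤ 100 * ((σ ^ r : ℕ) * Real.logb 2 (σ ^ r : ℕ)) := by
  have hT' : T ≤ σ ^ r * (Nat.clog 2 σ * 3 + r * 29 + 32) :=
    calc T ≤ Nat.clog 2 σ * 3 + r * 3 + 10 + k * (r * 26 + 22) := hT
      _ ≤ σ ^ r * (Nat.clog 2 σ * 3 + r * 3 + 10) + σ ^ r * (r * 26 + 22) := by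
        gcongr
        exact Nat.le_mul_of_pos_left _ (Nat.pow_pos hp.base_pos)
      _ = σ ^ r * (Nat.clog 2 σ * 3 + r * 29 + 32) := by ring
  calc (T : ℝ) ≤ (σ ^ r : ℕ) * (Nat.clog 2 σ * 3 + r * 29 + 32) := by exact_mod_cast hT'
    _ ≤ (σ ^ r : ℕ) * (100 * Real.logb 2 (σ ^ r : ℕ)) := by
      gcongr
      exact log_time_le_logb_pow hp
    _ = 100 * ((σ ^ r : ℕ) * Real.logb 2 (σ ^ r : ℕ)) := mul_left_comm _ _ _

end

end MetaBlock

/-- The program and the constant are uniform in `σ`, `N`, the word size `w ≥ log₂ N` and `S`.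
A machine with words of `w` bits has at least one word, so the space bound for arbitrary word sizes
is `O(N log σ + w)` bits, registers included; it is `O(N log σ)` bits as soon as `w = O(log N)`,
because `log N ≤ N log σ`. -/
theorem lemma8 :
    ∃ (m a : ℕ) (D : MetaBlock.OnlineStructure m a) (C : ℝ),
      ∀ (σ r N w : ℕ), 2 ≤ σ → 1 ≤ r → N = σ ^ r → N ≤ 2 ^ w →
        ∃ size : Fin a → ℕ,
          -- space
          (MetaBlock.spaceBits m w size : ℝ) ≤ C * (N * Real.logb 2 σ + w) ∧
          ∀ S : Fin N → Fin σ,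
            -- the structure can be set up
            (∃ t s, WordRAM.Exec w size D.setup (D.start σ r w) t s) ∧
            ∀ (k : ℕ) (s : WordRAM.State m a) (T : ℕ), D.Reach w size r S k s T →
              -- total maintenance time
              (T : ℝ) ≤ C * (N * Real.logb 2 N) ∧
              -- the next character can be appended
              (∀ hk : k < N, ∃ t s',
                WordRAM.Exec w size D.append (s.setReg D.charReg (S ⟨k, hk⟩ : ℕ)) t s') ∧
              -- queries
              (∀ A : Fin r → Fin σ, ∃ t s',
                WordRAM.Exec w size D.query (s.setReg D.argReg (MetaBlock.code A)) t s' ∧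
                (t : ℝ) ≤ C * Real.logb 2 N ∧
                (r ≤ k → ∃ A' : Fin r → Fin σ,
                  MetaBlock.IsBlock S k A' ∧
                  s'.reg D.blockReg = MetaBlock.code A' ∧
                  MetaBlock.ShiftMatch A' A (s'.reg D.shiftReg) ∧
                  (s'.reg D.shiftReg : ℕ∞) ≤ MetaBlock.minOffset S k A)) := by
  refine ⟨23, 3, MetaBlock.trieStructure, 100, ?_⟩
  rintro σ r N w hσ hr rfl hw
  have hp : MetaBlock.Admissible σ r w := ⟨hσ, hr, hw⟩
  refine ⟨MetaBlock.arraySize σ r w, MetaBlock.spaceBits_le hp, fun S => ⟨?_, ?_⟩⟩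
  · obtain ⟨t, s, hexec, -⟩ := MetaBlock.setup_invariant hp S
    exact ⟨t, s, hexec⟩
  intro k s T hreach
  obtain ⟨hk, hinv, hT⟩ := MetaBlock.reach_invariant hp hreach
  refine ⟨MetaBlock.updateTime_le hp hk hT, fun hk' => ?_, fun A => ?_⟩
  · obtain ⟨t, s', hexec, -⟩ := hinv.append_wp hp hk'
    exact ⟨t, s', hexec⟩
  · obtain ⟨t, s', hexec, ht, -, hanswer⟩ := hinv.query_wp hp A
    exact ⟨t, s', hexec, MetaBlock.queryTime_le hp ht,
      hanswer.exists_isBlock hp.base_pos hp.one_le hk⟩
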